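/- Let $\mathfrak o$ be a Dedekind domain which is not a field, let $K$ be its fraction field, let $L/K$ be an algebraic (possibly infinite) field extension, and let $\mathfrak O$ be the integral closure of $\mathfrak o$ in $L$. A fractional ideal of $\mathfrak O$ is a non-zero $\mathfrak O$-submodule $I$ of $L$ with $dI\subseteq\mathfrak O$ for some $d\in L^\times$. Let $\mathcal F(\mathfrak O)$ be the multiplicative monoid of fractional ideals, $\mathcal I(\mathfrak O)$ its group of invertible elements, and $\mathcal P(\mathfrak O)=\{a\mathfrak O : a\in L^\times\}$. Put $\mathrm{Cl}(\mathfrak O)=\mathcal F(\mathfrak O)/\mathcal P(\mathfrak O)$ (the ideal class semigroup) and $\mathrm{Pic}(\mathfrak O)=\mathcal I(\mathfrak O)/\mathcal P(\mathfrak O)$. For a monoid $M$ let $\mathrm{Reg}\,M$ be the set of all $a\in M$ for which there is $b\in M$ with $a=aba$. We say that $\mathfrak O$ has the finite character property if every non-zero element of $\mathfrak O$ is contained in only finitely many maximal ideals. For a maximal ideal $\mathfrak P$ of $\mathfrak O$ let $v_{\mathfrak P}\colon L^\times\to\mathbb Q$ be the unique additive valuation whose valuation ring is the localization $\mathfrak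 O_{\mathfrak P}$ and which satisfies $v_{\mathfrak P}(K^\times)=\mathbb Z$. Then $\mathrm{Cl}(\mathfrak O)$ is a Clifford semigroup, that is, $\mathrm{Reg}\,\mathrm{Cl}(\mathfrak O)=\mathrm{Cl}(\mathfrak O)$, if and only if $\mathfrak O$ has the finite character property. Moreover, if $\mathfrak O$ has the finite character property, then there is an isomorphism of monoids $$\mathrm{Cl}(\mathfrak O)/\mathrm{Pic}(\mathfrak O)\;\simeq\;\bigoplus_{\mathfrak P}\bigl(\{0\}\sqcup\mathbb R/v_{\mathfrak P}(L^\times)\bigr),$$ where $\mathfrak P$ runs through the maximal ideals of $\mathfrak O$ for which $v_{\mathfrak P}(L^\times)$ is dense in $\mathbb R$, and where $\{0\}\sqcup\mathbb R/v_{\mathfrak P}(L^\times)$ is the additive group $\mathbb R/v_{\mathfrak P}(L^\times)$ with a new neutral element $0$ adjoined. It can be chosen so that the $\mathfrak P$-component of the image of the class of $I\in\mathcal F(\mathfrak O)$ is $0$ if $v_{\mathfrak P}$ attains a minimum on $I\setminus\{0\}$, and is the class of $\inf\{v_{\mathfrak P}(x) : x\in I\setminus\{0\}\}$ in $\mathbb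 R/v_{\mathfrak P}(L^\times)$ otherwise. -/

import Mathlib

open scoped nonZeroDivisors DirectSum

namespace IdealClassSemigroup

/-- The set of von Neumann regular elements of a monoid. -/
def Reg (M : Type*) [Monoid M] : Set M := {a | ∃ b : M, a = a * b * a}

/-- The congruence on a commutative monoid `M` attached to a submonoid `N`:
`x ∼ y` iff `a x = b y` for some `a, b ∈ N`. It is the smallest congruence for which all elements
of `N` become trivial; if `N` is a group, its classes are the orbits of `N`. -/
def quotCon {M : Type*} [CommMonoid M] (N : Submonoid M) : Con M where
  r x y := ∃ a ∈ N, ∃ b ∈ N, a * x = b * y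
  iseqv :=
    { refl := fun _ => ⟨1, N.one_mem, 1, N.one_mem, rfl⟩
      symm := fun ⟨a, ha, b, hb, h⟩ => ⟨b, hb, a, ha, h.symm⟩
      trans := by
        rintro x y z ⟨a, ha, b, hb, h⟩ ⟨c, hc, d, hd, h2⟩
        refine ⟨c * a, N.mul_mem hc ha, b * d, N.mul_mem hb hd, ?_⟩
        rw [mul_assoc, h, mul_assoc, ← h2, mul_left_comm] }
  mul' := by
    rintro w x y z ⟨a, ha, b, hb, h⟩ ⟨c, hc, d, hd, h2⟩
    refine ⟨a * c, N.mul_mem ha hc, b * d, N.mul_mem hb hd, ?_⟩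
    rw [mul_mul_mul_comm, h, h2, mul_mul_mul_comm]

/-- The quotient monoid `M / N`. -/
abbrev QuotMonoid {M : Type*} [CommMonoid M] (N : Submonoid M) : Type _ := (quotCon N).Quotient

/-! ### Fractional ideals and ideal classes

In the following definitions `L` is meant to be the fraction field of the domain `R`. -/

/-- The monoid of non-zero fractional ideals of `R`. -/
def fracIdeals (R L : Type*) [CommRing R] [Field L] [Algebra R L] :
    Submonoid (FractionalIdeal R⁰ L) where
  carrier := {I | I ≠ 0}
  one_mem' := fun h => one_ne_zero
    ((FractionalIdeal.eq_zero_iff.1 h) 1 (FractionalIdeal.one_mem_one _))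
  mul_mem' := by
    intro I J hI hJ h
    simp only [Set.mem_ofPred_eq, ne_eq, FractionalIdeal.eq_zero_iff, not_forall] at hI hJ
    obtain ⟨x, hx, hx0⟩ := hI
    obtain ⟨y, hy, hy0⟩ := hJ
    exact mul_ne_zero hx0 hy0
      ((FractionalIdeal.eq_zero_iff.1 h) (x * y) (FractionalIdeal.mul_mem_mul hx hy))

/-- The submonoid (in fact group) of invertible fractional ideals. -/
def invertibleIdeals (R L : Type*) [CommRing R] [Field L] [Algebra R L] :
    Submonoid (fracIdeals R L) where
  carrier := {I | ∃ J : fracIdeals R L, I * J = 1}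
  one_mem' := ⟨1, mul_one 1⟩
  mul_mem' := by
    rintro I I' ⟨J, hJ⟩ ⟨J', hJ'⟩
    exact ⟨J * J', by rw [mul_mul_mul_comm, hJ, hJ', mul_one]⟩

/-- The submonoid (in fact group) of principal fractional ideals `a R` with `a ∈ L` non-zero. -/
def principalIdeals (R L : Type*) [CommRing R] [Field L] [Algebra R L] :
    Submonoid (fracIdeals R L) where
  carrier := {I | ∃ a : L, a ≠ 0 ∧
    ((I : FractionalIdeal R⁰ L) : Submodule R L) = Submodule.span R {a}}
  one_mem' := ⟨1, one_ne_zero, by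
    rw [OneMemClass.coe_one, FractionalIdeal.coe_one, Submodule.one_eq_span]⟩
  mul_mem' := by
    rintro I J ⟨a, ha, hI⟩ ⟨b, hb, hJ⟩
    exact ⟨a * b, mul_ne_zero ha hb, by
      rw [Submonoid.coe_mul, FractionalIdeal.coe_mul, hI, hJ, Submodule.span_mul_span,
        Set.singleton_mul_singleton]⟩

/-- The ideal class semigroup: fractional ideals modulo principal fractional ideals. -/
abbrev Cl (R L : Type*) [CommRing R] [Field L] [Algebra R L] : Type _ :=
  QuotMonoid (principalIdeals R L)

/-- The class of a fractional ideal in the ideal class semigroup. -/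
def Cl.mk {R L : Type*} [CommRing R] [Field L] [Algebra R L] : fracIdeals R L →* Cl R L :=
  (quotCon (principalIdeals R L)).mk'

/-- The Picard group, as the submonoid of the ideal class semigroup consisting of the classes of
invertible fractional ideals. -/
def Pic (R L : Type*) [CommRing R] [Field L] [Algebra R L] : Submonoid (Cl R L) :=
  (invertibleIdeals R L).map Cl.mk

/-- The ideal class semigroup modulo the Picard group. -/
abbrev ClModPic (R L : Type*) [CommRing R] [Field L] [Algebra R L] : Type _ :=
  QuotMonoid (Pic R L)

/-- The class of a fractional ideal in the ideal class semigroup modulo the Picard group. -/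
def ClModPic.mk {R L : Type*} [CommRing R] [Field L] [Algebra R L] :
    fracIdeals R L →* ClModPic R L :=
  ((quotCon (Pic R L)).mk').comp Cl.mk

/-- The finite character property: every non-zero element lies in only finitely many maximal
ideals. -/
def HasFiniteCharacter (R : Type*) [CommRing R] : Prop :=
  ∀ x : R, x ≠ 0 → {P : MaximalSpectrum R | x ∈ P.asIdeal}.Finite

/-! ### Normalized valuations -/

/-- `v` is the additive valuation of `L` attached to the maximal ideal `P` of the integral closure
of `o` in `L`, normalized on `K`: its valuation ring is the localization at `P`, viewed in `L`, and
it maps the non-zero elements of `K` onto the integers. (The valuation inequality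
`v (x + y) ≥ min (v x) (v y)` is the closedness of the valuation ring under addition.) -/
structure IsNormalizedValuation {o K L : Type*} [CommRing o] [Field K] [Field L] [Algebra o L]
    [Algebra K L] (P : MaximalSpectrum (integralClosure o L)) (v : Additive Lˣ →+ ℚ) : Prop where
  nonneg_iff : ∀ x : Lˣ, 0 ≤ v (Additive.ofMul x) ↔
    ∃ a s : integralClosure o L, s ∉ P.asIdeal ∧ (x : L) = (a : L) / (s : L)
  range_eq :
    Set.range (fun a : Kˣ => v (Additive.ofMul (Units.map (algebraMap K L).toMonoidHom a))) =
      Set.range ((↑) : ℤ → ℚ)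

open WithZero in
theorem exists_hom_of_torsion {K L Γ : Type*} [Field K] [Field L] [Algebra K L]
    [LinearOrderedCommGroupWithZero Γ] (V : Valuation L Γ) (w : Valuation K (WithZero (Multiplicative ℤ)))
    (h : ∀ a : K, V (algebraMap K L a) ≤ 1 ↔ w a ≤ 1)
    (ht : ∀ x : Lˣ, ∃ n : ℕ, 0 < n ∧ ∃ a : Kˣ, V (x : L) ^ n = V (algebraMap K L a)) :
    ∃ v : Additive Lˣ →+ ℚ, (∀ x : Lˣ, 0 ≤ v (Additive.ofMul x) ↔ V (x : L) ≤ 1) ∧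
      ∀ a : Kˣ, v (Additive.ofMul (Units.map (algebraMap K L).toMonoidHom a)) =
        ((-log (w (a : K)) : ℤ) : ℚ) := by
  have hle : ∀ a b : Kˣ, V (algebraMap K L a) ≤ V (algebraMap K L b) ↔ w (a : K) ≤ w (b : K) := by
    intro a b
    have hb : V (algebraMap K L b) ≠ 0 := by simp
    have hb' : w (b : K) ≠ 0 := by simp
    rw [← div_le_one₀ (zero_lt_iff.2 hb), ← div_le_one₀ (zero_lt_iff.2 hb'), ← map_div₀, ← map_div₀,
      ← map_div₀]
    exact h _
  have heq : ∀ a b : Kˣ, V (algebraMap K L a) = V (algebraMap K L b) → w (a : K) = w (b : K) :=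
    fun a b hab => le_antisymm ((hle a b).1 hab.le) ((hle b a).1 hab.ge)
  choose n hn a ha using ht
  -- independence of the choices
  have key : ∀ (x : Lˣ) (m : ℕ) (b : Kˣ), 0 < m → V (x : L) ^ m = V (algebraMap K L b) →
      ((-log (w (a x : K)) : ℤ) : ℚ) / n x = ((-log (w (b : K)) : ℤ) : ℚ) / m := by
    intro x m b hm hb
    have h1 : w ((a x ^ m : Kˣ) : K) = w ((b ^ n x : Kˣ) : K) := by
      apply heq
      rw [Units.val_pow_eq_pow_val, Units.val_pow_eq_pow_val, map_pow, map_pow, map_pow, map_pow,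
        ← ha, ← hb, ← pow_mul, ← pow_mul, mul_comm]
    rw [Units.val_pow_eq_pow_val, Units.val_pow_eq_pow_val, map_pow, map_pow] at h1
    have h2 := congrArg log h1
    rw [log_pow, log_pow] at h2
    have h3 : (m : ℚ) * (log (w (a x : K)) : ℤ) = (n x : ℚ) * (log (w (b : K)) : ℤ) := by
      have := congrArg (Int.cast : ℤ → ℚ) h2
      simpa using this
    have hm' : (m : ℚ) ≠ 0 := by positivity
    have hn' : (n x : ℚ) ≠ 0 := by have := hn x; positivity
    rw [div_eq_div_iff hn' hm']
    push_cast
    linarith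
  refine ⟨AddMonoidHom.mk' (fun x => ((-log (w (a x.toMul : K)) : ℤ) : ℚ) / n x.toMul) ?_, ?_, ?_⟩
  · intro x y
    have hx := hn x.toMul
    have hy := hn y.toMul
    have := key (x.toMul * y.toMul) (n x.toMul * n y.toMul)
      (a x.toMul ^ n y.toMul * a y.toMul ^ n x.toMul) (Nat.mul_pos hx hy) (by
        simp only [Units.val_mul, Units.val_pow_eq_pow_val, map_mul, map_pow, mul_pow, ← ha]
        rw [← pow_mul, ← pow_mul, mul_comm (n y.toMul)])
    rw [toMul_add, this]
    simp only [Units.val_mul, Units.val_pow_eq_pow_val, map_mul, map_pow]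
    rw [log_mul (by simp) (by simp), log_pow, log_pow]
    have hx' : (n x.toMul : ℚ) ≠ 0 := by positivity
    have hy' : (n y.toMul : ℚ) ≠ 0 := by positivity
    push_cast
    field_simp
    simp
    ring
  · intro x
    have hx := hn x
    have h1 : V (x : L) ≤ 1 ↔ log (w (a x : K)) ≤ 0 := by
      rw [← pow_le_one_iff (hn x).ne', ha, h, ← log_one,
        log_le_log (by simp) one_ne_zero]
    rw [h1]
    simp only [AddMonoidHom.mk'_apply, toMul_ofMul]
    rw [le_div_iff₀ (by exact_mod_cast hx), zero_mul]
    norm_cast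
    omega
  · intro b
    simp only [AddMonoidHom.mk'_apply, toMul_ofMul]
    rw [key _ 1 b one_pos (by simp)]
    simp

theorem exists_torsion {K L Γ : Type*} [Field K] [Field L] [Algebra K L]
    [Algebra.IsAlgebraic K L]
    [LinearOrderedCommGroupWithZero Γ] (V : Valuation L Γ) (x : Lˣ) : 
    ∃ n : ℕ, 0 < n ∧ ∃ a : Kˣ, V (x : L) ^ n = V (algebraMap K L a) := by
  obtain ⟨p, hp, hpx⟩ := Algebra.IsAlgebraic.isAlgebraic (R := K) (x : L)
  rw [Polynomial.aeval_eq_sum_range] at hpx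
  obtain ⟨i, hi, hmax⟩ := Finset.exists_max_image (Finset.range (p.natDegree + 1))
    (fun i => V (p.coeff i • (x : L) ^ i)) ⟨0, by simp⟩
  have hpos : V (p.coeff i • (x : L) ^ i) ≠ 0 := by
    have := hmax p.natDegree (by simp)
    refine (lt_of_lt_of_le (zero_lt_iff.2 ?_) this).ne'
    simpa [Algebra.smul_def] using hp
  obtain ⟨j, hj, hij, he⟩ : ∃ j ∈ Finset.range (p.natDegree + 1), j ≠ i ∧
      V (p.coeff j • (x : L) ^ j) = V (p.coeff i • (x : L) ^ i) := by
    by_contra! hcon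
    have := V.map_sum_eq_of_lt hi (f := fun i => p.coeff i • (x : L) ^ i) fun k hk => by
      have hk := Finset.mem_sdiff.1 hk
      exact lt_of_le_of_ne (hmax k hk.1) (hcon k hk.1 (by simpa using hk.2))
    rw [hpx, map_zero] at this
    exact hpos this.symm
  have main : ∀ i j : ℕ, i < j → V (p.coeff j • (x : L) ^ j) = V (p.coeff i • (x : L) ^ i) →
      V (p.coeff i • (x : L) ^ i) ≠ 0 →
      ∃ n : ℕ, 0 < n ∧ ∃ a : Kˣ, V (x : L) ^ n = V (algebraMap K L a) := by
    intro i j hij he hne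
    have hci : p.coeff i ≠ 0 := fun h0 => hne (by simp [h0])
    have hcj : p.coeff j ≠ 0 := fun h0 => (he ▸ hne) (by simp [h0])
    refine ⟨j - i, by omega, Units.mk0 (p.coeff i / p.coeff j) (div_ne_zero hci hcj), ?_⟩
    obtain ⟨d, rfl⟩ := Nat.exists_eq_add_of_lt hij
    have h1 : i + d + 1 - i = d + 1 := by omega
    simp only [Algebra.smul_def, map_mul, map_pow] at he
    rw [h1, Units.val_mk0, map_div₀, map_div₀, eq_div_iff (by simpa using hcj)]
    have hx : V (x : L) ^ i ≠ 0 := by simp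
    apply mul_right_cancel₀ hx
    rw [mul_right_comm, ← pow_add, mul_comm, ← he, add_comm (d + 1), add_assoc]
  rcases lt_or_gt_of_ne hij with h | h
  · exact main j i h he.symm (he ▸ hpos)
  · exact main i j h he hpos
theorem exists_or_exists_inv_of_root {A L : Type*} [CommRing A] [IsDomain A] [IsLocalRing A] [IsIntegrallyClosed A] [Field L] [Algebra A L]
    [IsFractionRing A L] (u : L) : ∀ (n : ℕ) (a : ℕ → A), (∃ i ≤ n, IsUnit (a i)) →
    ∑ i ∈ Finset.range (n + 1), algebraMap A L (a i) * u ^ i = 0 →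
    (∃ b, algebraMap A L b = u) ∨ ∃ b, algebraMap A L b = u⁻¹ := by
  intro n
  induction n with
  | zero =>
    rintro a ⟨i, hi, hu⟩ h
    obtain rfl : i = 0 := by omega
    have : algebraMap A L (a 0) = 0 := by simpa using h
    exact absurd this ((hu.map (algebraMap A L)).ne_zero)
  | succ n ih =>
    rintro a ⟨i, hi, hu⟩ h
    obtain ⟨b, hb⟩ : ∃ b, algebraMap A L b = algebraMap A L (a (n + 1)) * u := by
      by_cases h0 : a (n + 1) = 0
      · exact ⟨0, by simp [h0]⟩
      let p : Polynomial A := ∑ i ∈ Finset.range (n + 2), Polynomial.C (a i) * Polynomial.X ^ i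
      have hc : p.coeff (n + 1) = a (n + 1) := by
        simp [p, Polynomial.finsetSum_coeff, Polynomial.coeff_C_mul, Polynomial.coeff_X_pow]
      have hd : p.natDegree = n + 1 := by
        refine Polynomial.natDegree_eq_of_le_of_coeff_ne_zero ?_ (by rwa [hc])
        refine Polynomial.natDegree_sum_le_of_forall_le _ _ fun j hj => ?_
        refine (Polynomial.natDegree_C_mul_X_pow_le _ _).trans ?_
        have := Finset.mem_range.1 hj
        omega
      have hr : Polynomial.aeval u p = 0 := by
        simpa [p] using h
      have := isIntegral_leadingCoeff_smul p u hr
      rw [Polynomial.leadingCoeff, hd, hc, Algebra.smul_def] at this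
      exact IsIntegrallyClosed.isIntegral_iff.1 this
    have h' : ∑ i ∈ Finset.range (n + 1),
        algebraMap A L (Function.update a n (b + a n) i) * u ^ i = 0 := by
      rw [Finset.sum_range_succ] at h ⊢
      rw [Finset.sum_range_succ] at h
      have : ∀ i ∈ Finset.range n, algebraMap A L (Function.update a n (b + a n) i) * u ^ i =
          algebraMap A L (a i) * u ^ i := fun i hi => by
        rw [Function.update_of_ne (Finset.mem_range.1 hi).ne]
      rw [Finset.sum_congr rfl this, Function.update_self, map_add, hb, ← h]
      ring
    rcases Nat.lt_or_ge i n with hin | hin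
    · exact ih _ ⟨i, hin.le, by rwa [Function.update_of_ne hin.ne]⟩ h'
    rcases hin.eq_or_lt with rfl | hin
    · by_cases hbu : IsUnit b
      · right
        obtain ⟨c, hc⟩ := hbu.exists_right_inv
        have hc' : algebraMap A L b * algebraMap A L c = 1 := by rw [← map_mul, hc, map_one]
        refine ⟨a (n + 1) * c, eq_inv_of_mul_eq_one_left ?_⟩
        rw [map_mul, ← hc', hb]
        ring
      · refine ih _ ⟨n, le_rfl, ?_⟩ h'
        rw [Function.update_self]
        have : IsUnit ((b + a n) + -b) := by simpa using hu
        exact (IsLocalRing.isUnit_or_isUnit_of_isUnit_add this).resolve_right (by simpa using hbu)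
    · left
      obtain rfl : i = n + 1 := by omega
      obtain ⟨c, hc⟩ := hu.exists_right_inv
      have hc' : algebraMap A L (a (n + 1)) * algebraMap A L c = 1 := by rw [← map_mul, hc, map_one]
      refine ⟨c * b, ?_⟩
      rw [map_mul, hb, ← mul_assoc, mul_comm (algebraMap A L c), hc', one_mul]

theorem IsNormalizedValuation.eq {o K L : Type*} [CommRing o] [Field K] [Field L] [Algebra o L]
    [Algebra K L] {P : MaximalSpectrum (integralClosure o L)} {v v' : Additive Lˣ →+ ℚ}
    (hv : IsNormalizedValuation (K := K) P v) (hv' : IsNormalizedValuation (K := K) P v') :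
    v = v' := by
  have hnn : ∀ x, 0 ≤ v x ↔ 0 ≤ v' x := fun x =>
    (hv.nonneg_iff x.toMul).trans (hv'.nonneg_iff x.toMul).symm
  have hz : ∀ x, v x = 0 → v' x = 0 := by
    intro x hx
    have h1 := (hnn x).1 hx.ge
    have h2 := (hnn (-x)).1 (by rw [map_neg, hx, neg_zero])
    rw [map_neg] at h2
    linarith
  obtain ⟨a, ha⟩ : (1 : ℚ) ∈ Set.range (fun a : Kˣ =>
      v (Additive.ofMul (Units.map (algebraMap K L).toMonoidHom a))) := hv.range_eq ▸ ⟨1, by simp⟩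
  obtain ⟨b, hb⟩ : (1 : ℚ) ∈ Set.range (fun a : Kˣ =>
      v' (Additive.ofMul (Units.map (algebraMap K L).toMonoidHom a))) := hv'.range_eq ▸ ⟨1, by simp⟩
  obtain ⟨k, hk⟩ : v' (Additive.ofMul (Units.map (algebraMap K L).toMonoidHom a)) ∈
      Set.range ((↑) : ℤ → ℚ) := hv'.range_eq ▸ ⟨a, rfl⟩
  obtain ⟨m, hm⟩ : v (Additive.ofMul (Units.map (algebraMap K L).toMonoidHom b)) ∈
      Set.range ((↑) : ℤ → ℚ) := hv.range_eq ▸ ⟨b, rfl⟩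
  dsimp only at ha hb
  set α := Additive.ofMul (Units.map (algebraMap K L).toMonoidHom a)
  set β := Additive.ofMul (Units.map (algebraMap K L).toMonoidHom b)
  have hmk : (1 : ℚ) = m * k := by
    have := hz (β - m • α) (by rw [map_sub, map_zsmul, ha, ← hm]; simp)
    rw [map_sub, map_zsmul, hb, ← hk, sub_eq_zero] at this
    simpa using this
  have hk0 : 0 ≤ k := by
    have := (hnn α).1 (by rw [ha]; norm_num)
    rw [← hk] at this
    exact_mod_cast this
  have hk1 : k = 1 := by
    have h : m * k = 1 := by exact_mod_cast hmk.symm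
    exact Int.eq_one_of_dvd_one hk0 ⟨m, by rw [mul_comm]; exact h.symm⟩
  rw [hk1] at hk
  refine AddMonoidHom.ext fun x => ?_
  have hd : ((v x).den : ℚ) ≠ 0 := by exact_mod_cast (v x).den_ne_zero
  have := hz ((v x).den • x - (v x).num • α) (by
    rw [map_sub, map_nsmul, map_zsmul, ha]
    simp [Rat.den_mul_eq_num])
  rw [map_sub, map_nsmul, map_zsmul, ← hk, sub_eq_zero] at this
  have h2 : ((v x).den : ℚ) * v' x = (v x).num := by simpa using this
  rw [← Rat.den_mul_eq_num] at h2
  exact (mul_left_cancel₀ hd h2).symm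

theorem exists_isNormalizedValuation {o K L : Type*} [CommRing o] [IsDedekindDomain o]
    (ho : ¬ IsField o) [Field K] [Algebra o K] [IsFractionRing o K] [Field L] [Algebra K L]
    [Algebra.IsAlgebraic K L] [Algebra o L] [IsScalarTower o K L]
    (P : MaximalSpectrum (integralClosure o L)) :
    ∃ v : Additive Lˣ →+ ℚ, IsNormalizedValuation (K := K) P v := by
  have hinj : ∀ x : o, algebraMap o L x = 0 → x = 0 := fun x hx => by
    rw [IsScalarTower.algebraMap_apply o K L] at hx
    exact IsFractionRing.to_map_eq_zero_iff.1 ((map_eq_zero _).1 hx)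
  have : Algebra.IsAlgebraic o L := ⟨fun x =>
    (IsFractionRing.isAlgebraic_iff o K L).2 (Algebra.IsAlgebraic.isAlgebraic x)⟩
  have : IsFractionRing (integralClosure o L) L :=
    integralClosure.isFractionRing_of_algebraic hinj
  have := P.isMaximal
  have : IsIntegrallyClosed (integralClosure o L) :=
    (isIntegrallyClosed_iff_isIntegrallyClosedIn L).2 inferInstance
  let p : Ideal o := P.asIdeal.comap (algebraMap o (integralClosure o L))
  have hpm : p.IsMaximal := Ideal.isMaximal_comap_of_isIntegral_of_isMaximal P.asIdeal
  let q : IsDedekindDomain.HeightOneSpectrum o :=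
    ⟨p, hpm.isPrime, Ring.ne_bot_of_isMaximal_of_not_isField hpm ho⟩
  let w := q.valuation K
  let A := Localization.subalgebra.ofField L P.asIdeal.primeCompl
    P.asIdeal.primeCompl_le_nonZeroDivisors
  have : IsLocalRing A := IsLocalization.AtPrime.isLocalRing A P.asIdeal
  have : IsIntegrallyClosed A :=
    isIntegrallyClosed_of_isLocalization A P.asIdeal.primeCompl
      P.asIdeal.primeCompl_le_nonZeroDivisors
  have hA : ∀ x : L, x ∈ A ↔ ∃ a s : integralClosure o L, s ∉ P.asIdeal ∧ x = (a : L) / (s : L) := by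
    intro x
    simp only [div_eq_mul_inv]
    exact ⟨fun ⟨a, s, hs, hx⟩ => ⟨a, s, hs, hx⟩, fun ⟨a, s, hs, hx⟩ => ⟨a, s, hs, hx⟩⟩
  have hcoe : ∀ a : o, algebraMap K L (algebraMap o K a) =
      ((algebraMap o (integralClosure o L) a : integralClosure o L) : L) := fun a =>
    (IsScalarTower.algebraMap_apply o K L a).symm
  -- elements of `K` that are integral at `p` lie in the local ring at `P`
  have hfrac : ∀ a : K, w a ≤ 1 → ∃ n d : o, d ∉ p ∧ a = algebraMap o K n / algebraMap o K d := by
    intro a ha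
    obtain ⟨n, d, hnd⟩ := q.exists_primeCompl_mul_eq_of_integer a ha
    refine ⟨n, d, d.2, ?_⟩
    have : algebraMap o K d ≠ 0 := fun h => d.2 (by
      rw [IsFractionRing.to_map_eq_zero_iff.1 h]; exact Ideal.zero_mem _)
    rw [eq_div_iff this, hnd]
  have hmem : ∀ a : K, w a ≤ 1 → algebraMap K L a ∈ A := by
    intro a ha
    obtain ⟨n, d, hd, rfl⟩ := hfrac a ha
    exact (hA _).2 ⟨_, _, hd, by rw [map_div₀, hcoe, hcoe]⟩
  have hnot : ∀ a : K, 1 < w a → algebraMap K L a ∉ A := by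
    intro a ha hmemA
    have ha0 : a ≠ 0 := by rintro rfl; simp at ha
    have hlt : w a⁻¹ < 1 := by rw [map_inv₀]; exact inv_lt_one_of_one_lt₀ ha
    obtain ⟨n, d, hd, hnd⟩ := hfrac _ hlt.le
    obtain ⟨b, s, hs, hbs⟩ := (hA _).1 hmemA
    have hd0 : algebraMap o K d ≠ 0 := fun h => hd (by
      rw [IsFractionRing.to_map_eq_zero_iff.1 h]; exact Ideal.zero_mem _)
    have hs0 : (s : L) ≠ 0 := fun h => hs (by
      have h0 : s = 0 := Subtype.ext h
      rw [h0]; exact Ideal.zero_mem _)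
    have hn : n ∈ p := by
      refine (q.valuation_lt_one_iff_mem (K := K) n).1 ?_
      have : algebraMap o K n = a⁻¹ * algebraMap o K d := by rw [hnd]; field_simp
      change q.valuation K (algebraMap o K n) < 1
      rw [this, map_mul]
      exact mul_lt_one_of_lt_of_le hlt (q.valuation_le_one d)
    have h1 : algebraMap o (integralClosure o L) n * b =
        algebraMap o (integralClosure o L) d * s := by
      apply Subtype.ext
      have h2 : algebraMap K L a⁻¹ * algebraMap K L a = 1 := by
        rw [← map_mul, inv_mul_cancel₀ ha0, map_one]
      have hd1 : ((algebraMap o (integralClosure o L) d : integralClosure o L) : L) ≠ 0 := by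
        rw [← hcoe]; simpa using hd0
      rw [hnd, hbs, map_div₀, hcoe, hcoe] at h2
      field_simp at h2
      simpa using h2
    have h3 : algebraMap o (integralClosure o L) d * s ∈ P.asIdeal :=
      h1 ▸ Ideal.mul_mem_right _ _ hn
    rcases P.isMaximal.isPrime.mem_or_mem h3 with h | h
    · exact hd h
    · exact hs h
  -- the local ring at `P` is a valuation ring
  have hval : ∀ x : L, x ∈ A ∨ x⁻¹ ∈ A := by
    intro x
    obtain ⟨f, hf, hfx⟩ := Algebra.IsAlgebraic.isAlgebraic (R := K) x
    rw [Polynomial.aeval_eq_sum_range] at hfx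
    obtain ⟨i, hi, hmax⟩ := Finset.exists_max_image (Finset.range (f.natDegree + 1))
      (fun i => w (f.coeff i)) ⟨0, by simp⟩
    have hpos : w (f.coeff i) ≠ 0 := by
      have := hmax f.natDegree (by simp)
      refine (lt_of_lt_of_le (zero_lt_iff.2 ?_) this).ne'
      simpa using hf
    have hci : f.coeff i ≠ 0 := by simpa using hpos
    have hle : ∀ j, j < f.natDegree + 1 → w (f.coeff j / f.coeff i) ≤ 1 := by
      intro j hj
      rw [map_div₀]
      exact (div_le_one₀ (zero_lt_iff.2 hpos)).2 (hmax j (by simpa using hj))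
    let c : ℕ → A := fun j => if hj : j < f.natDegree + 1 then
      ⟨algebraMap K L (f.coeff j / f.coeff i), hmem _ (hle j hj)⟩ else 0
    have hi' : i < f.natDegree + 1 := by simpa using hi
    have := exists_or_exists_inv_of_root (A := A) x f.natDegree c ⟨i, by omega, by
      have : c i = 1 := by
        apply Subtype.ext
        simp only [c, hi', dite_true, div_self hci, map_one]
        rfl
      rw [this]; exact isUnit_one⟩ (by
      have : ∀ j ∈ Finset.range (f.natDegree + 1), algebraMap A L (c j) * x ^ j =
          algebraMap K L (f.coeff i)⁻¹ * (f.coeff j • x ^ j) := fun j hj => by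
        have hj' : j < f.natDegree + 1 := by simpa using hj
        have : algebraMap A L (c j) = algebraMap K L (f.coeff j / f.coeff i) := by
          simp only [c, hj', dite_true]; rfl
        rw [this, Algebra.smul_def, div_eq_mul_inv, map_mul]
        ring
      rw [Finset.sum_congr rfl this, ← Finset.mul_sum, hfx, mul_zero])
    rcases this with ⟨b, hb⟩ | ⟨b, hb⟩
    · exact Or.inl (hb ▸ b.2)
    · exact Or.inr (hb ▸ b.2)
  let V := (ValuationSubring.ofSubring A.toSubring hval).valuation
  have hV : ∀ x : L, V x ≤ 1 ↔ x ∈ A := fun x => ValuationSubring.valuation_le_one_iff _ x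
  obtain ⟨v, hv1, hv2⟩ := exists_hom_of_torsion V w
    (fun a => (hV _).trans ⟨fun h => not_lt.1 fun h' => hnot a h' h, hmem a⟩)
    (exists_torsion (K := K) V)
  refine ⟨v, fun x => (hv1 x).trans ((hV _).trans (hA _)), ?_⟩
  ext r
  constructor
  · rintro ⟨a, rfl⟩
    exact ⟨_, (hv2 a).symm⟩
  · rintro ⟨n, rfl⟩
    obtain ⟨a, ha⟩ := q.valuation_surjective (K := K) (WithZero.exp (-n))
    have ha0 : a ≠ 0 := by
      rintro rfl
      rw [map_zero] at ha
      exact WithZero.exp_ne_zero ha.symm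
    refine ⟨Units.mk0 a ha0, (hv2 _).trans ?_⟩
    have : w (Units.mk0 a ha0 : Kˣ) = WithZero.exp (-n) := ha
    rw [this]
    simp

theorem existsUnique_isNormalizedValuation {o K L : Type*} [CommRing o] [IsDedekindDomain o]
    (ho : ¬ IsField o) [Field K] [Algebra o K] [IsFractionRing o K] [Field L] [Algebra K L]
    [Algebra.IsAlgebraic K L] [Algebra o L] [IsScalarTower o K L]
    (P : MaximalSpectrum (integralClosure o L)) :
    ∃! v : Additive Lˣ →+ ℚ, IsNormalizedValuation (K := K) P v := by
  obtain ⟨v, hv⟩ := exists_isNormalizedValuation (K := K) ho P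
  exact ⟨v, hv, fun v' hv' => hv'.eq hv⟩

/-- The normalized additive valuation of `L` attached to `P`. -/
noncomputable def val {o : Type*} (K : Type*) {L : Type*} [CommRing o] [IsDedekindDomain o]
    (ho : ¬ IsField o) [Field K] [Algebra o K] [IsFractionRing o K] [Field L] [Algebra K L]
    [Algebra.IsAlgebraic K L] [Algebra o L] [IsScalarTower o K L]
    (P : MaximalSpectrum (integralClosure o L)) : Additive Lˣ →+ ℚ :=
  (existsUnique_isNormalizedValuation (K := K) ho P).choose

theorem val_spec {o : Type*} (K : Type*) {L : Type*} [CommRing o] [IsDedekindDomain o]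
    (ho : ¬ IsField o) [Field K] [Algebra o K] [IsFractionRing o K] [Field L] [Algebra K L]
    [Algebra.IsAlgebraic K L] [Algebra o L] [IsScalarTower o K L]
    (P : MaximalSpectrum (integralClosure o L)) : IsNormalizedValuation (K := K) P (val K ho P) :=
  (existsUnique_isNormalizedValuation (K := K) ho P).choose_spec.1

/-- The value group of the normalized valuation at `P`, as a subgroup of the real numbers. -/
noncomputable def valueGroup {o : Type*} (K : Type*) {L : Type*} [CommRing o] [IsDedekindDomain o]
    (ho : ¬ IsField o) [Field K] [Algebra o K] [IsFractionRing o K] [Field L] [Algebra K L]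
    [Algebra.IsAlgebraic K L] [Algebra o L] [IsScalarTower o K L]
    (P : MaximalSpectrum (integralClosure o L)) : AddSubgroup ℝ :=
  (((Rat.castHom ℝ).toAddMonoidHom).comp (val K ho P)).range

/-- The values at `P` of the non-zero elements of the fractional ideal `I`. -/
def valuesAt {o : Type*} (K : Type*) {L : Type*} [CommRing o] [IsDedekindDomain o]
    (ho : ¬ IsField o) [Field K] [Algebra o K] [IsFractionRing o K] [Field L] [Algebra K L]
    [Algebra.IsAlgebraic K L] [Algebra o L] [IsScalarTower o K L]
    (P : MaximalSpectrum (integralClosure o L))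
    (I : fracIdeals (integralClosure o L) L) : Set ℝ :=
  {r | ∃ x : Lˣ, (x : L) ∈ (I : FractionalIdeal (integralClosure o L)⁰ L) ∧
    r = (val K ho P (Additive.ofMul x) : ℝ)}

open Classical in
/-- The local component at `P` of the fractional ideal `I`, in `{0} ⊔ ℝ / v_P(Lˣ)`: it is the
additional zero if the valuation at `P` attains its infimum on `I`, and the class of this infimum
otherwise. Here `WithZero G`, for an additive group `G`, is `G` with a new neutral element `0`
adjoined. -/
noncomputable def component {o : Type*} (K : Type*) {L : Type*} [CommRing o] [IsDedekindDomain o]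
    (ho : ¬ IsField o) [Field K] [Algebra o K] [IsFractionRing o K] [Field L] [Algebra K L]
    [Algebra.IsAlgebraic K L] [Algebra o L] [IsScalarTower o K L]
    (P : MaximalSpectrum (integralClosure o L))
    (I : fracIdeals (integralClosure o L) L) : WithZero (ℝ ⧸ valueGroup K ho P) :=
  if sInf (valuesAt K ho P I) ∈ valuesAt K ho P I then 0
  else ((sInf (valuesAt K ho P I) : ℝ) : ℝ ⧸ valueGroup K ho P)

end IdealClassSemigroup

open IdealClassSemigroup

namespace IdealClassSemigroup

/-! Write `R` for the integral closure. Its localizations at maximal ideals are valuation rings with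
rational value groups, and a fractional ideal `I` is determined by its value sets `v P (I \ {0})`:
`x` lies in `I` as soon as, for every `P`, its value is taken on `I`
(`IsLocalizationFamily.mem_of_forall`, `IsLocalizationFamily.ext`). Value sets are upward closed in
the value group, and they add when ideals are multiplied. So at each `P` an ideal is a cut of the
value group: closed, if the infimum is attained, or open at some real number `r`. An open cut that
is not closed forces the value group to be dense.

Under finite character an ideal is trivial at almost all `P`, and conversely any family of cuts that
is trivial almost everywhere comes from an ideal (`IsLocalizationFamily.exists_valueSet_eq`). A
family of principal local ideals thus glues to an invertible ideal. Modulo such ideals every closed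
cut becomes trivial, and an open cut retains only the class of `r` modulo the value group. This is
the isomorphism (`IsLocalizationFamily.exists_addEquiv`). Each summand is a group with a neutral
element adjoined, so `Cl/Pic` is a Clifford semigroup; regularity lifts to `Cl`, because the
invertible factor in `I = A * (I * J * I)` can be absorbed into `J`.

Conversely, suppose that some `d ≠ 0` lies in infinitely many maximal ideals. Since `R` has
dimension at most one, there are infinitely many pairwise comaximal, proper, finitely generated
ideals `B n` containing `d` (`exists_comaximal_seq`). They are invertible, as `R` is a Prüfer
domain. The union `I` of the inverses of `B 0 * ... * B (n - 1)` is fractional with denominator `d`.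
Its multiplier ring is `R`, so `I = I * J * I` would force `I * J = 1`; then `1` already lies in the
product of `J` with one member of the union, which makes some `B n` the unit ideal
(`exists_ne_mul_mul_self`). -/

/-- The family `v` consists of valuations of `L` whose valuation rings are the localizations of `R`
at its maximal ideals. -/
def IsLocalizationFamily {R L : Type*} [CommRing R] [Field L] [Algebra R L]
    (v : MaximalSpectrum R → Additive Lˣ →+ ℚ) : Prop :=
  ∀ (P : MaximalSpectrum R) (x : Lˣ), 0 ≤ v P (.ofMul x) ↔
    ∃ a s : R, s ∉ P.asIdeal ∧ (x : L) = algebraMap R L a / algebraMap R L s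

/-- The values under `w` of the non-zero elements of the fractional ideal `I`. -/
def valueSet {R L : Type*} [CommRing R] [Field L] [Algebra R L] (w : Additive Lˣ →+ ℚ)
    (I : FractionalIdeal R⁰ L) : Set ℚ :=
  {q | ∃ x : Lˣ, (x : L) ∈ I ∧ w (.ofMul x) = q}

theorem one_notMem {R : Type*} [CommRing R] (P : MaximalSpectrum R) : (1 : R) ∉ P.asIdeal :=
  (Ideal.ne_top_iff_one _).1 P.isMaximal.ne_top

/-! ### Fractional ideals and their local value sets -/

section

variable {R L : Type*} [CommRing R] [Field L] [Algebra R L]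

theorem exists_unit_of_ne_zero [IsFractionRing R L] {a : R} (ha : a ≠ 0) :
    ∃ u : Lˣ, (u : L) = algebraMap R L a :=
  ⟨Units.mk0 _ (by simpa using ha), rfl⟩

theorem exists_unit_mem {I : FractionalIdeal R⁰ L} (hI : I ≠ 0) : ∃ x : Lˣ, (x : L) ∈ I := by
  by_contra! h
  exact hI (FractionalIdeal.eq_zero_iff.2 fun x hx => by
    by_contra h0
    exact h (Units.mk0 x h0) hx)

theorem algebraMap_mul_mem (I : FractionalIdeal R⁰ L) (a : R) {x : L} (hx : x ∈ I) :
    algebraMap R L a * x ∈ I := by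
  rw [← Algebra.smul_def]
  exact Submodule.smul_mem (I : Submodule R L) a hx

namespace IsLocalizationFamily

variable [IsFractionRing R L] {v : MaximalSpectrum R → Additive Lˣ →+ ℚ}
  (hv : IsLocalizationFamily v)
include hv

theorem exists_mul_eq {P : MaximalSpectrum R} {x : Lˣ} (hx : 0 ≤ v P (.ofMul x)) :
    ∃ a s : R, s ∉ P.asIdeal ∧ algebraMap R L s * (x : L) = algebraMap R L a := by
  obtain ⟨a, s, hs, h⟩ := (hv P x).1 hx
  have hs0 : algebraMap R L s ≠ 0 := by
    simpa using fun h0 : s = 0 => hs (h0 ▸ Ideal.zero_mem _)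
  exact ⟨a, s, hs, by rw [h]; field_simp⟩

theorem nonneg_of_mul_eq {P : MaximalSpectrum R} {x : Lˣ} {a s : R} (hs : s ∉ P.asIdeal)
    (h : algebraMap R L s * (x : L) = algebraMap R L a) : 0 ≤ v P (.ofMul x) := by
  have hs0 : algebraMap R L s ≠ 0 := by
    simpa using fun h0 : s = 0 => hs (h0 ▸ Ideal.zero_mem _)
  exact (hv P x).2 ⟨a, s, hs, by rw [← h]; field_simp⟩

theorem nonneg_algebraMap (P : MaximalSpectrum R) {u : Lˣ} {a : R} (h : (u : L) = algebraMap R L a) :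
    0 ≤ v P (.ofMul u) :=
  hv.nonneg_of_mul_eq (one_notMem P) (a := a) (by rw [map_one, one_mul, h])

theorem eq_zero_iff {P : MaximalSpectrum R} {u : Lˣ} {a : R} (h : (u : L) = algebraMap R L a) :
    v P (.ofMul u) = 0 ↔ a ∉ P.asIdeal := by
  constructor
  · intro h0 ha
    obtain ⟨b, s, hs, hb⟩ := hv.exists_mul_eq (P := P) (x := u⁻¹) (by simp [h0])
    apply hs
    have : s = b * a := IsFractionRing.injective R L (by
      rw [map_mul, ← hb, ← h]; simp)
    exact this ▸ Ideal.mul_mem_left _ _ ha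
  · intro ha
    have := hv.nonneg_of_mul_eq (x := u⁻¹) ha (a := 1) (by rw [← h]; simp)
    rw [ofMul_inv, map_neg] at this
    exact le_antisymm (by linarith) (hv.nonneg_algebraMap P h)

theorem pos_iff {P : MaximalSpectrum R} {u : Lˣ} {a : R} (h : (u : L) = algebraMap R L a) :
    0 < v P (.ofMul u) ↔ a ∈ P.asIdeal := by
  rw [(hv.nonneg_algebraMap P h).lt_iff_ne, ne_comm, Ne, hv.eq_zero_iff h, not_not]

/-- The ultrametric inequality is closure of the valuation ring under addition: `z / x = 1 + y / x`.
-/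
theorem le_add_of_le {P : MaximalSpectrum R} {x y z : Lˣ} (hz : (z : L) = x + y)
    (h : v P (.ofMul x) ≤ v P (.ofMul y)) : v P (.ofMul x) ≤ v P (.ofMul z) := by
  obtain ⟨a, s, hs, hb⟩ := hv.exists_mul_eq (P := P) (x := y / x) (by simpa using h)
  have := hv.nonneg_of_mul_eq (x := z / x) hs (a := s + a) (by
    rw [map_add, ← hb, Units.val_div_eq_div_val, Units.val_div_eq_div_val, hz]
    field_simp)
  simpa using this

theorem le_add {P : MaximalSpectrum R} {x y z : Lˣ} (hz : (z : L) = x + y) {q : ℚ}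
    (hx : q ≤ v P (.ofMul x)) (hy : q ≤ v P (.ofMul y)) : q ≤ v P (.ofMul z) := by
  rcases le_total (v P (.ofMul x)) (v P (.ofMul y)) with h | h
  · exact hx.trans (hv.le_add_of_le hz h)
  · exact hy.trans (hv.le_add_of_le (hz.trans (add_comm _ _)) h)

theorem mem_valueSet_of_le {P : MaximalSpectrum R} {I : FractionalIdeal R⁰ L} {q : ℚ}
    (hq : q ∈ valueSet (v P) I) {x : Lˣ} (h : q ≤ v P (.ofMul x)) :
    ∃ s : R, s ∉ P.asIdeal ∧ algebraMap R L s * (x : L) ∈ I := by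
  obtain ⟨y, hy, rfl⟩ := hq
  obtain ⟨a, s, hs, hb⟩ := hv.exists_mul_eq (P := P) (x := x / y) (by simpa using h)
  refine ⟨s, hs, ?_⟩
  have : algebraMap R L s * (x : L) = algebraMap R L a * y := by
    rw [← hb, Units.val_div_eq_div_val]; field_simp
  rw [this]
  exact algebraMap_mul_mem I a hy

/-- Value sets are upward closed within the value group: the multiplier `s` that moves `x` into `I`
is a unit at `P`, so it does not change the value. -/
theorem val_mem_valueSet {P : MaximalSpectrum R} {I : FractionalIdeal R⁰ L} {q : ℚ}
    (hq : q ∈ valueSet (v P) I) {x : Lˣ} (h : q ≤ v P (.ofMul x)) :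
    v P (.ofMul x) ∈ valueSet (v P) I := by
  obtain ⟨s, hs, hsx⟩ := hv.mem_valueSet_of_le hq h
  obtain ⟨u, hu⟩ := exists_unit_of_ne_zero (L := L)
    (fun h0 : s = 0 => hs (h0 ▸ Ideal.zero_mem _))
  refine ⟨u * x, by rwa [Units.val_mul, hu], ?_⟩
  rw [ofMul_mul, map_add, (hv.eq_zero_iff hu).2 hs, zero_add]

theorem mem_of_forall {I : FractionalIdeal R⁰ L} {x : Lˣ}
    (h : ∀ P, v P (.ofMul x) ∈ valueSet (v P) I) : (x : L) ∈ I := by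
  -- The conductor of `x` into `I`; by hypothesis no maximal ideal contains it.
  let A : Ideal R :=
    { carrier := {s | algebraMap R L s * (x : L) ∈ I}
      add_mem' := fun {s t} hs ht => by
        simp only [Set.mem_ofPred_eq, map_add, add_mul] at *
        exact Submodule.add_mem (I : Submodule R L) hs ht
      zero_mem' := by
        simp only [Set.mem_ofPred_eq, map_zero, zero_mul]
        exact Submodule.zero_mem (I : Submodule R L)
      smul_mem' := fun r s hs => by
        simp only [Set.mem_ofPred_eq, smul_eq_mul, map_mul, mul_assoc] at *
        exact algebraMap_mul_mem I r hs }
  have hA : A = ⊤ := by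
    by_contra hne
    obtain ⟨M, hM, hle⟩ := Ideal.exists_le_maximal A hne
    obtain ⟨s, hs, hsx⟩ := hv.mem_valueSet_of_le (h ⟨M, hM⟩) le_rfl
    exact hs (hle hsx)
  have h1 : (1 : R) ∈ A := hA ▸ Submodule.mem_top
  have : algebraMap R L 1 * (x : L) ∈ I := h1
  simpa using this

theorem mem_iff {I : FractionalIdeal R⁰ L} {x : Lˣ} :
    (x : L) ∈ I ↔ ∀ P, v P (.ofMul x) ∈ valueSet (v P) I :=
  ⟨fun h _ => ⟨x, h, rfl⟩, hv.mem_of_forall⟩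

theorem ext {I J : FractionalIdeal R⁰ L} (h : ∀ P, valueSet (v P) I = valueSet (v P) J) :
    I = J := by
  ext x
  rcases eq_or_ne x 0 with rfl | hx
  · exact ⟨fun _ => Submodule.zero_mem (J : Submodule R L),
      fun _ => Submodule.zero_mem (I : Submodule R L)⟩
  · have hI := hv.mem_iff (I := I) (x := Units.mk0 x hx)
    have hJ := hv.mem_iff (I := J) (x := Units.mk0 x hx)
    simp only [Units.val_mk0, h] at hI hJ
    exact hI.trans hJ.symm

theorem mem_one_iff {x : Lˣ} :
    (x : L) ∈ (1 : FractionalIdeal R⁰ L) ↔ ∀ P, 0 ≤ v P (.ofMul x) := by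
  constructor
  · intro h P
    obtain ⟨a, ha⟩ := (FractionalIdeal.mem_one_iff _).1 h
    exact hv.nonneg_algebraMap P ha.symm
  · intro h
    refine hv.mem_of_forall fun P => hv.val_mem_valueSet (q := 0) ⟨1, ?_, by simp⟩ (h P)
    rw [Units.val_one]
    exact FractionalIdeal.one_mem_one _

theorem mem_valueSet_one {P : MaximalSpectrum R} {q : ℚ} :
    q ∈ valueSet (v P) (1 : FractionalIdeal R⁰ L) ↔ 0 ≤ q ∧ ∃ x : Lˣ, v P (.ofMul x) = q := by
  constructor
  · rintro ⟨x, hx, rfl⟩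
    exact ⟨hv.mem_one_iff.1 hx P, x, rfl⟩
  · rintro ⟨h, x, rfl⟩
    refine hv.val_mem_valueSet (q := 0) ⟨1, ?_, by simp⟩ h
    rw [Units.val_one]
    exact FractionalIdeal.one_mem_one _

theorem exists_le_of_mem_mul {P : MaximalSpectrum R} {I J : FractionalIdeal R⁰ L} {x : L}
    (hx : x ∈ I * J) : ∀ u : Lˣ, (u : L) = x →
      ∃ a ∈ valueSet (v P) I, ∃ b ∈ valueSet (v P) J, a + b ≤ v P (.ofMul u) := by
  refine FractionalIdeal.mul_induction_on (C := fun x => ∀ u : Lˣ, (u : L) = x →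
      ∃ a ∈ valueSet (v P) I, ∃ b ∈ valueSet (v P) J, a + b ≤ v P (.ofMul u)) hx ?_ ?_
  · intro i hi j hj u hu
    have h0 : i * j ≠ 0 := hu ▸ u.ne_zero
    let y := Units.mk0 i (left_ne_zero_of_mul h0)
    let z := Units.mk0 j (right_ne_zero_of_mul h0)
    have : u = y * z := Units.ext hu
    exact ⟨_, ⟨y, hi, rfl⟩, _, ⟨z, hj, rfl⟩, by rw [this, ofMul_mul, map_add]⟩
  · intro x y ihx ihy u hu
    rcases eq_or_ne x 0 with rfl | hx
    · exact ihy u (by rw [hu, zero_add])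
    rcases eq_or_ne y 0 with rfl | hy
    · exact ihx u (by rw [hu, add_zero])
    obtain ⟨a, ha, b, hb, hab⟩ := ihx (Units.mk0 x hx) rfl
    obtain ⟨c, hc, d, hd, hcd⟩ := ihy (Units.mk0 y hy) rfl
    rcases le_total (v P (.ofMul (Units.mk0 x hx))) (v P (.ofMul (Units.mk0 y hy))) with h | h
    · exact ⟨a, ha, b, hb, hv.le_add hu hab (hab.trans h)⟩
    · exact ⟨c, hc, d, hd, hv.le_add hu (hcd.trans h) hcd⟩

/-- An element of `I * J` is a sum of products, so its value is only bounded below by some `a + b`;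
upward closedness then lets `a` be enlarged until equality holds. -/
theorem mem_valueSet_mul {P : MaximalSpectrum R} {I J : FractionalIdeal R⁰ L} {q : ℚ} :
    q ∈ valueSet (v P) (I * J) ↔ ∃ a ∈ valueSet (v P) I, ∃ b ∈ valueSet (v P) J, a + b = q := by
  constructor
  · rintro ⟨x, hx, rfl⟩
    obtain ⟨a, ha, b, ⟨z, hz, rfl⟩, hab⟩ := hv.exists_le_of_mem_mul (P := P) hx x rfl
    refine ⟨_, hv.val_mem_valueSet (x := x / z) ha ?_, _, ⟨z, hz, rfl⟩, ?_⟩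
    · rw [ofMul_div, map_sub]; linarith
    · rw [ofMul_div, map_sub]; ring
  · rintro ⟨_, ⟨x, hx, rfl⟩, _, ⟨y, hy, rfl⟩, rfl⟩
    exact ⟨x * y, FractionalIdeal.mul_mem_mul hx hy, by rw [ofMul_mul, map_add]⟩

end IsLocalizationFamily
end

/-! ### Finitely generated ideals are invertible -/

section Prufer

variable {R L : Type*} [CommRing R] [Field L] [Algebra R L] [IsFractionRing R L]
  {v : MaximalSpectrum R → Additive Lˣ →+ ℚ}

theorem IsLocalizationFamily.exists_mul_eq_mul (hv : IsLocalizationFamily v)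
    (P : MaximalSpectrum R) (x y : R) :
    (∃ s r : R, s ∉ P.asIdeal ∧ s * y = r * x) ∨ ∃ s r : R, s ∉ P.asIdeal ∧ s * x = r * y := by
  have main : ∀ u w : Lˣ, ∀ x y : R, (u : L) = algebraMap R L x → (w : L) = algebraMap R L y →
      v P (.ofMul u) ≤ v P (.ofMul w) → ∃ s r : R, s ∉ P.asIdeal ∧ s * y = r * x := by
    intro u w x y hu hw h
    obtain ⟨r, s, hs, hr⟩ := hv.exists_mul_eq (P := P) (x := w / u) (by simpa using h)
    refine ⟨s, r, hs, IsFractionRing.injective R L ?_⟩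
    rw [map_mul, map_mul, ← hr, ← hu, ← hw, Units.val_div_eq_div_val]
    field_simp
  have h1 := one_notMem P
  by_cases hx : x = 0
  · exact Or.inr ⟨1, 0, h1, by simp [hx]⟩
  by_cases hy : y = 0
  · exact Or.inl ⟨1, 0, h1, by simp [hy]⟩
  obtain ⟨u, hu⟩ := exists_unit_of_ne_zero (L := L) hx
  obtain ⟨w, hw⟩ := exists_unit_of_ne_zero (L := L) hy
  rcases le_total (v P (.ofMul u)) (v P (.ofMul w)) with h | h
  · exact Or.inl (main u w x y hu hw h)
  · exact Or.inr (main w u y x hw hu h)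

/-- Of two elements one divides the other locally at `P`, so generators can be discarded one by one;
`s` is a common denominator for the resulting divisibilities. -/
theorem IsLocalizationFamily.exists_local_generator (hv : IsLocalizationFamily v)
    (P : MaximalSpectrum R) {A : Ideal R} (hA : A.FG) :
    ∃ x ∈ A, ∃ s ∉ P.asIdeal, ∀ a ∈ A, ∃ r, s * a = r * x := by
  have hP := P.isMaximal.isPrime
  have key : ∀ (A B : Ideal R) (x y s t w q : R), x ∈ A → s ∉ P.asIdeal → t ∉ P.asIdeal →
      w ∉ P.asIdeal → w * y = q * x → (∀ a ∈ A, ∃ r, s * a = r * x) →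
      (∀ b ∈ B, ∃ r, t * b = r * y) →
      ∃ x ∈ A ⊔ B, ∃ s ∉ P.asIdeal, ∀ a ∈ A ⊔ B, ∃ r, s * a = r * x := by
    intro A B x y s t w q hx hs ht hw hq hA hB
    refine ⟨x, Ideal.mem_sup_left hx, s * t * w, ?_, ?_⟩
    · exact fun h => (hP.mem_or_mem h).elim (fun h => (hP.mem_or_mem h).elim hs ht) hw
    · intro c hc
      obtain ⟨a, ha, b, hb, rfl⟩ := Submodule.mem_sup.1 hc
      obtain ⟨r, hr⟩ := hA a ha
      obtain ⟨r', hr'⟩ := hB b hb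
      exact ⟨t * w * r + s * r' * q, by
        linear_combination t * w * hr + s * w * hr' + s * r' * hq⟩
  refine Submodule.fg_induction (motive := fun A _ =>
    ∃ x ∈ A, ∃ s ∉ P.asIdeal, ∀ a ∈ A, ∃ r, s * a = r * x) ?_ ?_ A hA
  · intro x
    refine ⟨x, Submodule.mem_span_singleton_self x, 1, one_notMem P, ?_⟩
    intro a ha
    obtain ⟨r, rfl⟩ := Submodule.mem_span_singleton.1 ha
    exact ⟨r, by simp⟩
  · rintro A B _ _ ⟨x, hx, s, hs, hA⟩ ⟨y, hy, t, ht, hB⟩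
    rcases hv.exists_mul_eq_mul P x y with ⟨w, q, hw, hq⟩ | ⟨w, q, hw, hq⟩
    · exact key A B x y s t w q hx hs ht hw hq hA hB
    · rw [sup_comm]
      exact key B A y x t s w q hy ht hs hw hq hB hA

theorem IsLocalizationFamily.isUnit_coeIdeal_of_fg [IsDomain R] (hv : IsLocalizationFamily v)
    {A : Ideal R} (hA : A.FG) (h0 : A ≠ ⊥) : IsUnit (A : FractionalIdeal R⁰ L) := by
  have hA0 : (A : FractionalIdeal R⁰ L) ≠ 0 := FractionalIdeal.coeIdeal_ne_zero.2 h0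
  refine IsUnit.of_mul_eq_one (1 / (A : FractionalIdeal R⁰ L)) ?_
  refine le_antisymm FractionalIdeal.mul_one_div_le_one ?_
  have h1 : ((1 : Lˣ) : L) ∈ (A : FractionalIdeal R⁰ L) * (1 / A) := by
    refine hv.mem_of_forall fun P => ?_
    obtain ⟨x, hx, s, hs, h⟩ := hv.exists_local_generator P hA
    obtain ⟨a, ha, ha0⟩ := Submodule.exists_mem_ne_zero_of_ne_bot h0
    have hs0 : s ≠ 0 := fun h0 => hs (h0 ▸ Ideal.zero_mem _)
    have hx0 : x ≠ 0 := by
      rintro rfl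
      obtain ⟨r, hr⟩ := h a ha
      exact mul_ne_zero hs0 ha0 (by rw [hr, mul_zero])
    have hx0' : algebraMap R L x ≠ 0 := by simpa using hx0
    obtain ⟨u, hu⟩ := exists_unit_of_ne_zero (L := L) hs0
    -- The denominator `s` has value `0` at `P`, like `1`, and `s = x * (s / x)` with `s / x` in the
    -- inverse ideal.
    refine ⟨u, ?_, by rw [(hv.eq_zero_iff hu).2 hs]; simp⟩
    have : (u : L) = algebraMap R L x * (u / algebraMap R L x) := by field_simp
    rw [this]
    refine FractionalIdeal.mul_mem_mul (FractionalIdeal.mem_coeIdeal_of_mem _ hx)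
      ((FractionalIdeal.mem_div_iff_of_ne_zero hA0).2 fun y hy => ?_)
    obtain ⟨b, hb, rfl⟩ := (FractionalIdeal.mem_coeIdeal _).1 hy
    obtain ⟨r, hr⟩ := h b hb
    refine (FractionalIdeal.mem_one_iff _).2 ⟨r, ?_⟩
    have := congrArg (algebraMap R L) hr
    rw [map_mul, map_mul] at this
    rw [hu, div_mul_eq_mul_div, this]
    field_simp
  rw [Units.val_one] at h1
  exact FractionalIdeal.one_le.2 h1

end Prufer

/-! ### Comaximal sequences in dimension at most one -/

section Comaximal

variable {R : Type*} [CommRing R] [Ring.DimensionLEOne R]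

/-- Every prime containing `d` is maximal, so modulo it `e` is zero or invertible. Hence no prime
containing `d` avoids the multiplicative set of all `e ^ n * (1 - e * y)`, and this set must meet
the ideal generated by `d`. -/
theorem exists_pow_mul_mem_span {d : R} (hd : d ≠ 0) (e : R) :
    ∃ (n : ℕ) (y : R), e ^ n * (1 - e * y) ∈ Ideal.span {d} := by
  let S : Submonoid R :=
    { carrier := {x | ∃ (n : ℕ) (y : R), x = e ^ n * (1 - e * y)}
      one_mem' := ⟨0, 0, by simp⟩
      mul_mem' := by
        rintro _ _ ⟨n, y, rfl⟩ ⟨m, z, rfl⟩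
        exact ⟨n + m, y + z - e * y * z, by ring⟩ }
  by_contra! hcon
  have hdis : Disjoint (Ideal.span {d} : Set R) (S : Set R) :=
    Set.disjoint_left.2 fun x hx ⟨n, y, hxy⟩ => hcon n y (hxy ▸ hx)
  obtain ⟨p, hp, hle, hpS⟩ := Ideal.exists_le_prime_disjoint _ S hdis
  have hdp : d ∈ p := hle (Ideal.mem_span_singleton_self d)
  have hpm : p.IsMaximal :=
    Ring.DimensionLEOne.maximalOfPrime (fun h => hd (by simpa [h] using hdp)) hp
  have he : e ∉ p := fun h => Set.disjoint_left.1 hpS h ⟨1, 0, by simp⟩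
  obtain ⟨y, i, hi, h⟩ := hpm.exists_inv he
  exact Set.disjoint_left.1 hpS hi ⟨0, y, by linear_combination h⟩

/-- On the set of maximal ideals containing `d`, the element `f = e * y` behaves like an idempotent,
which cuts this set into two clopen pieces. -/
theorem exists_separating {d : R} (hd : d ≠ 0) {P Q : MaximalSpectrum R} (hPQ : P ≠ Q)
    (hQ : d ∈ Q.asIdeal) : ∃ f ∈ P.asIdeal, f ∉ Q.asIdeal ∧
      ∀ M : MaximalSpectrum R, d ∈ M.asIdeal → f ∈ M.asIdeal ∨ 1 - f ∈ M.asIdeal := by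
  obtain ⟨e, heP, heQ⟩ : ∃ e ∈ P.asIdeal, e ∉ Q.asIdeal := by
    by_contra! h
    exact hPQ (MaximalSpectrum.ext (P.isMaximal.eq_of_le Q.isMaximal.ne_top h))
  obtain ⟨n, y, hy⟩ := exists_pow_mul_mem_span hd e
  have hor : ∀ M : MaximalSpectrum R, d ∈ M.asIdeal → e ∈ M.asIdeal ∨ 1 - e * y ∈ M.asIdeal := by
    intro M hM
    have : e ^ n * (1 - e * y) ∈ M.asIdeal :=
      (Ideal.span_singleton_le_iff_mem _).2 hM hy
    exact (M.isMaximal.isPrime.mem_or_mem this).imp_left (M.isMaximal.isPrime.mem_of_pow_mem n)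
  refine ⟨e * y, Ideal.mul_mem_right _ _ heP, fun h => ?_, fun M hM => ?_⟩
  · have := (hor Q hQ).resolve_left heQ
    exact one_notMem Q (by simpa using Ideal.add_mem _ this h)
  · exact (hor M hM).imp_left fun h => Ideal.mul_mem_right _ _ h

/-- The maximal ideals above `A` are distributed between those above `A + (f)` and those above `A +
(1 - f)`. A piece that is infinite supplies `C`; the other contains `P` or `Q` and supplies the
proper ideal `B`. -/
theorem exists_comaximal_split {d : R} (hd : d ≠ 0) {A : Ideal R} (hA : A.FG) (hdA : d ∈ A)
    (hinf : {M : MaximalSpectrum R | A ≤ M.asIdeal}.Infinite) :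
    ∃ B C : Ideal R, B.FG ∧ C.FG ∧ A ≤ B ∧ A ≤ C ∧ B ⊔ C = ⊤ ∧ B ≠ ⊤ ∧
      {M : MaximalSpectrum R | C ≤ M.asIdeal}.Infinite := by
  obtain ⟨P, hP, Q, hQ, hPQ⟩ := hinf.nontrivial
  obtain ⟨f, hfP, hfQ, hf⟩ := exists_separating hd hPQ (hQ hdA)
  have hfg : ∀ g, (A ⊔ Ideal.span {g}).FG := fun g => Submodule.FG.sup hA ⟨{g}, by simp⟩
  have hle : ∀ (M : MaximalSpectrum R) g, A ≤ M.asIdeal → g ∈ M.asIdeal →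
      A ⊔ Ideal.span {g} ≤ M.asIdeal := fun M g hM hg =>
    sup_le hM ((Ideal.span_singleton_le_iff_mem _).2 hg)
  have htop : A ⊔ Ideal.span {f} ⊔ (A ⊔ Ideal.span {1 - f}) = ⊤ := by
    rw [Ideal.eq_top_iff_one]
    have h1 : f ∈ A ⊔ Ideal.span {f} := Ideal.mem_sup_right (Ideal.mem_span_singleton_self f)
    have h2 : 1 - f ∈ A ⊔ Ideal.span {1 - f} :=
      Ideal.mem_sup_right (Ideal.mem_span_singleton_self _)
    simpa using Ideal.add_mem _ (Ideal.mem_sup_left h1) (Ideal.mem_sup_right h2)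
  have hne : ∀ (M : MaximalSpectrum R) g, A ≤ M.asIdeal → g ∈ M.asIdeal →
      A ⊔ Ideal.span {g} ≠ ⊤ := fun M g hM hg h =>
    M.isMaximal.ne_top (top_le_iff.1 (h ▸ hle M g hM hg))
  have hsub : {M : MaximalSpectrum R | A ≤ M.asIdeal} ⊆
      {M | A ⊔ Ideal.span {f} ≤ M.asIdeal} ∪ {M | A ⊔ Ideal.span {1 - f} ≤ M.asIdeal} :=
    fun M hM => (hf M (hM hdA)).imp (hle M f hM) (hle M (1 - f) hM)
  rcases Set.infinite_union.1 (hinf.mono hsub) with h | h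
  · exact ⟨_, _, hfg (1 - f), hfg f, le_sup_left, le_sup_left, by rw [sup_comm, htop],
      hne Q _ hQ ((hf Q (hQ hdA)).resolve_left hfQ), h⟩
  · exact ⟨_, _, hfg f, hfg (1 - f), le_sup_left, le_sup_left, htop, hne P _ hP hfP, h⟩

theorem exists_comaximal_seq {d : R} (hd : d ≠ 0)
    (hinf : {M : MaximalSpectrum R | d ∈ M.asIdeal}.Infinite) :
    ∃ B : ℕ → Ideal R, (∀ n, (B n).FG ∧ d ∈ B n ∧ B n ≠ ⊤) ∧
      Pairwise (Function.onFun IsCoprime B) := by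
  let T := {A : Ideal R // A.FG ∧ d ∈ A ∧ {M : MaximalSpectrum R | A ≤ M.asIdeal}.Infinite}
  have step : ∀ A : T, ∃ (B : Ideal R) (C : T), B.FG ∧ A.1 ≤ B ∧ A.1 ≤ C.1 ∧ B ⊔ C.1 = ⊤ ∧
      B ≠ ⊤ := by
    rintro ⟨A, hA, hdA, hAi⟩
    obtain ⟨B, C, hB, hC, hAB, hAC, h, hne, hi⟩ := exists_comaximal_split hd hA hdA hAi
    exact ⟨B, ⟨C, hC, hAC hdA, hi⟩, hB, hAB, hAC, h, hne⟩
  choose B C hB hAB hAC htop hne using step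
  let A : ℕ → T := fun n => Nat.rec ⟨Ideal.span {d}, ⟨{d}, by simp⟩,
    Ideal.mem_span_singleton_self d, by simpa [Ideal.span_singleton_le_iff_mem] using hinf⟩
    (fun _ A => C A) n
  have hmono : Monotone fun n => (A n).1 := monotone_nat_of_le_succ fun n => hAC (A n)
  -- `B (A n)` contains `A n`, hence `A (m + 1) = C (A m)`, which is comaximal with `B (A m)`.
  have hlt : ∀ m n, m < n → IsCoprime (B (A m)) (B (A n)) := by
    intro m n hmn
    rw [Ideal.isCoprime_iff_sup_eq, ← top_le_iff, ← htop (A m)]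
    exact sup_le_sup_left ((hmono (Nat.succ_le_of_lt hmn)).trans (hAB _)) _
  refine ⟨fun n => B (A n), fun n => ⟨hB _, hAB _ (A n).2.2.1, hne _⟩, fun m n hmn => ?_⟩
  rcases lt_or_gt_of_ne hmn with h | h
  · exact hlt m n h
  · exact (hlt n m h).symm

end Comaximal

/-! ### A fractional ideal that is not regular -/

section DirectedUnion

variable {R L : Type*} [CommRing R] [Field L] [Algebra R L]

/-- If `I` is the union of an increasing sequence `W`, then so is `I * X` of `W n * X`. -/
theorem exists_mem_mul_of_directed {W : ℕ → FractionalIdeal R⁰ L} (hW : Monotone W)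
    {I : FractionalIdeal R⁰ L} (hI : ∀ x ∈ I, ∃ n, x ∈ W n) (X : FractionalIdeal R⁰ L) (k : ℕ)
    {x : L} (hx : x ∈ I * X) : ∃ n, k ≤ n ∧ x ∈ W n * X := by
  refine FractionalIdeal.mul_induction_on (C := fun x => ∃ n, k ≤ n ∧ x ∈ W n * X) hx ?_ ?_
  · intro i hi j hj
    obtain ⟨n, hn⟩ := hI i hi
    exact ⟨max k n, le_max_left _ _,
      FractionalIdeal.mul_mem_mul (hW (le_max_right _ _) hn) hj⟩
  · rintro x y ⟨m, hm, hx⟩ ⟨n, hn, hy⟩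
    refine ⟨max m n, hm.trans (le_max_left _ _), ?_⟩
    exact Submodule.add_mem ((W (max m n) * X : FractionalIdeal R⁰ L) : Submodule R L)
      (mul_le_mul' (hW (le_max_left m n)) le_rfl hx)
      (mul_le_mul' (hW (le_max_right m n)) le_rfl hy)

/-- The union of an increasing sequence of fractional ideals with a common denominator. -/
theorem exists_eq_union {W : ℕ → FractionalIdeal R⁰ L} (hW : Monotone W) {d : R} (hd : d ∈ R⁰)
    (h : ∀ n, ∀ x ∈ W n, algebraMap R L d * x ∈ (1 : FractionalIdeal R⁰ L)) :
    ∃ I : FractionalIdeal R⁰ L, ∀ x, x ∈ I ↔ ∃ n, x ∈ W n := by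
  have hdir : Directed (· ≤ ·) fun n => (W n : Submodule R L) :=
    (Monotone.directed_le fun m n hmn => hW hmn)
  refine ⟨⟨⨆ n, (W n : Submodule R L), d, hd, fun x hx => ?_⟩, fun x => ?_⟩
  · obtain ⟨n, hn⟩ := (Submodule.mem_iSup_of_directed _ hdir).1 hx
    obtain ⟨a, ha⟩ := (FractionalIdeal.mem_one_iff _).1 (h n x hn)
    exact ⟨a, by rw [ha, Algebra.smul_def]⟩
  · exact Submodule.mem_iSup_of_directed _ hdir

/-- The union of the inverses of the finite products of a sequence of pairwise comaximal proper
invertible ideals with a common non-zero element is not regular. -/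
theorem exists_ne_mul_mul_self [IsFractionRing R L] {B : ℕ → Ideal R}
    (hB : ∀ n, IsUnit (B n : FractionalIdeal R⁰ L)) (hne : ∀ n, B n ≠ ⊤) {d : R} (hd0 : d ∈ R⁰)
    (hd : ∀ n, d ∈ B n) (hcop : Pairwise (Function.onFun IsCoprime B)) :
    ∃ I : FractionalIdeal R⁰ L, I ≠ 0 ∧ ∀ J, I ≠ I * J * I := by
  let f : Ideal R →+* FractionalIdeal R⁰ L := FractionalIdeal.coeIdealHom R⁰ L
  have hf1 : ∀ A : Ideal R, f A ≤ 1 := fun A => FractionalIdeal.coeIdeal_le_one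
  let c : ℕ → Ideal R := fun n => ∏ i ∈ Finset.range n, B i
  let e : ℕ → ℕ → Ideal R := fun m n => ∏ i ∈ Finset.Ico m n, B i
  have hce : ∀ {m n}, m ≤ n → f (c m) * f (e m n) = f (c n) := fun {m n} h => by
    rw [← map_mul, Finset.prod_range_mul_prod_Ico B h]
  have hcop' : ∀ m n, f (c m) + f (e m n) = 1 := fun m n => by
    have : IsCoprime (c m) (e m n) := IsCoprime.prod_left fun i hi => IsCoprime.prod_right
      fun j hj => hcop (by have := Finset.mem_range.1 hi; have := Finset.mem_Ico.1 hj; omega)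
    rw [← map_add, this.add_eq, map_one]
  have hcu : ∀ n, IsUnit (f (c n)) := fun n => by
    simp only [c, map_prod]
    exact Finset.prod_induction _ IsUnit (fun _ _ => IsUnit.mul) isUnit_one fun i _ => hB i
  choose W hW using fun n => (hcu n).exists_right_inv
  -- By comaximality the products are intersections, so they all contain `d`, which is therefore a
  -- common denominator of their inverses `W n`.
  have hdc : ∀ n, d ∈ c n := fun n => by
    simp only [c]
    rw [Ideal.prod_eq_iInf_of_pairwise_isCoprime fun i _ j _ hij => hcop hij]
    simpa using fun i _ => hd i
  have hWe : ∀ {m n}, m ≤ n → W m = W n * f (e m n) := fun {m n} h =>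
    (hcu m).mul_right_injective (by
      change f (c m) * W m = f (c m) * (W n * f (e m n))
      rw [hW, mul_left_comm, hce h, mul_comm, hW])
  have hmono : Monotone W := fun m n h => by
    rw [hWe h]
    exact (mul_le_mul' le_rfl (hf1 _)).trans_eq (mul_one _)
  obtain ⟨I, hI⟩ := exists_eq_union hmono hd0 fun n x hx => by
    rw [← hW n]
    exact FractionalIdeal.mul_mem_mul (FractionalIdeal.mem_coeIdeal_of_mem _ (hdc n)) hx
  have hWI : ∀ n, W n ≤ I := fun n x hx => (hI x).2 ⟨n, hx⟩
  have hIW := fun x hx => (hI x).1 hx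
  have hW0 : W 0 = 1 := by
    have := hW 0
    rwa [show c 0 = 1 from rfl, map_one, one_mul] at this
  have h1I : (1 : L) ∈ I := (hI 1).2 ⟨0, by rw [hW0]; exact FractionalIdeal.one_mem_one _⟩
  refine ⟨I, fun h => one_ne_zero (FractionalIdeal.eq_zero_iff.1 h 1 h1I), fun J hJ => ?_⟩
  -- the multipliers of `I` are integral
  have hmul : ∀ x : L, (∀ y ∈ I, x * y ∈ I) → x ∈ (1 : FractionalIdeal R⁰ L) := by
    intro x hx
    -- From `x ∈ W m` follows `x * c m ⊆ R`. From `x * W m ⊆ I` follows `x ∈ I * c m`, so `x ∈ W n *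
    -- c m` for some `n ≥ m`, and `x * e m n ⊆ R`. Now `c m + e m n = 1` gives `x ∈ R`.
    obtain ⟨m, hm⟩ := hIW x (by simpa using hx 1 h1I)
    have h1 : FractionalIdeal.spanSingleton R⁰ x * W m ≤ I := by
      refine FractionalIdeal.spanSingleton_mul_le_iff.2 fun y hy => hx y (hWI m hy)
    have h2 : x ∈ I * f (c m) := by
      rw [← FractionalIdeal.spanSingleton_le_iff_mem (S := R⁰)]
      calc FractionalIdeal.spanSingleton R⁰ x
          = FractionalIdeal.spanSingleton R⁰ x * W m * f (c m) := by
            rw [mul_assoc, mul_comm (W m), hW, mul_one]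
        _ ≤ I * f (c m) := mul_le_mul' h1 le_rfl
    obtain ⟨n, hmn, hn⟩ := exists_mem_mul_of_directed hmono hIW _ m h2
    rw [← FractionalIdeal.spanSingleton_le_iff_mem] at hm hn ⊢
    calc FractionalIdeal.spanSingleton R⁰ x
        = FractionalIdeal.spanSingleton R⁰ x * f (c m) +
            FractionalIdeal.spanSingleton R⁰ x * f (e m n) := by
          rw [← mul_add, hcop', mul_one]
      _ ≤ W m * f (c m) + W n * f (c m) * f (e m n) :=
          add_le_add (mul_le_mul' hm le_rfl) (mul_le_mul' hn le_rfl)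
      _ = 1 := by
          rw [mul_assoc (W n), hce hmn, mul_comm, hW, mul_comm, hW, ← FractionalIdeal.sup_eq_add,
            sup_idem]
  have hIJ : I * J ≤ 1 := FractionalIdeal.mul_le.2 fun i hi j hj => hmul _ fun y hy => by
    rw [hJ]
    exact FractionalIdeal.mul_mem_mul (FractionalIdeal.mul_mem_mul hi hj) hy
  -- Since `1 ∈ I = I * (I * J)`, some `c n` lies in `I * J`. The same argument applied to `1 ∈ I *
  -- c n = I * (I * J * c n)` puts some `e n m` into `I * J`, and `c n + e n m = 1`.
  have h1IJ : 1 ≤ I * J := by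
    have h1 : (1 : L) ∈ I * (I * J) := by rw [mul_comm, ← hJ]; exact h1I
    obtain ⟨n, -, hn⟩ := exists_mem_mul_of_directed hmono hIW _ 0 h1
    rw [← FractionalIdeal.one_le] at hn
    have hcn : f (c n) ≤ I * J := calc
      f (c n) = f (c n) * 1 := (mul_one _).symm
      _ ≤ f (c n) * (W n * (I * J)) := mul_le_mul' le_rfl hn
      _ = I * J := by rw [← mul_assoc, hW, one_mul]
    have h2 : (1 : L) ∈ I * (I * J * f (c n)) := by
      rw [← FractionalIdeal.one_le]
      calc 1 = W n * f (c n) := by rw [mul_comm, hW]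
        _ ≤ I * f (c n) := mul_le_mul' (hWI n) le_rfl
        _ = I * (I * J * f (c n)) := by
          rw [← mul_assoc I]; nth_rw 1 [hJ]; rw [mul_comm I (I * J)]
    obtain ⟨m, hnm, hm⟩ := exists_mem_mul_of_directed hmono hIW _ n h2
    rw [← FractionalIdeal.one_le] at hm
    have hen : f (e n m) ≤ I * J := calc
      f (e n m) = f (e n m) * 1 := (mul_one _).symm
      _ ≤ f (e n m) * (W m * (I * J * f (c n))) := mul_le_mul' le_rfl hm
      _ = (f (c n) * f (e n m)) * W m * (I * J) := by ring
      _ = I * J := by rw [hce hnm, hW, one_mul]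
    rw [← hcop' n m, ← sup_idem (I * J), FractionalIdeal.sup_eq_add]
    exact add_le_add hcn hen
  -- As `1 ∈ W n * J`, the ideal `J` contains `c n`; so `W (n + 1) * c n`, the inverse of `B n`,
  -- lies in `I * J ≤ 1`, although `B n` is proper.
  obtain ⟨n, -, hn⟩ := exists_mem_mul_of_directed hmono hIW _ 0 (FractionalIdeal.one_le.1 h1IJ)
  rw [← FractionalIdeal.one_le] at hn
  have hcJ : f (c n) ≤ J := calc
    f (c n) = f (c n) * 1 := (mul_one _).symm
    _ ≤ f (c n) * (W n * J) := mul_le_mul' le_rfl hn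
    _ = J := by rw [← mul_assoc, hW, one_mul]
  have hcs : f (c (n + 1)) = f (c n) * f (B n) := by
    rw [← map_mul]; simp only [c, Finset.prod_range_succ]
  have hBn : 1 ≤ f (B n) := calc
    1 = W (n + 1) * f (c n) * f (B n) := by rw [mul_assoc, ← hcs, mul_comm, hW]
    _ ≤ I * J * f (B n) := mul_le_mul' (mul_le_mul' (hWI _) hcJ) le_rfl
    _ ≤ 1 * f (B n) := mul_le_mul' hIJ le_rfl
    _ = f (B n) := one_mul _
  obtain ⟨b, hb, hb1⟩ := (FractionalIdeal.mem_coeIdeal _).1 (FractionalIdeal.one_le.1 hBn)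
  have : b = 1 := IsFractionRing.injective R L (by rw [hb1, map_one])
  exact hne n ((Ideal.eq_top_iff_one _).2 (this ▸ hb))

end DirectedUnion

/-! ### Regular classes, and necessity of finite character -/

section Classes

variable {R L : Type*} [CommRing R] [Field L] [Algebra R L]

theorem exists_mul_eq_one_of_mem_principalIdeals {I : fracIdeals R L}
    (hI : I ∈ principalIdeals R L) [IsFractionRing R L] : ∃ J ∈ principalIdeals R L, I * J = 1 := by
  obtain ⟨a, ha, h⟩ := hI
  have ha' : FractionalIdeal.spanSingleton R⁰ a⁻¹ ≠ 0 :=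
    FractionalIdeal.spanSingleton_ne_zero_iff.2 (inv_ne_zero ha)
  refine ⟨⟨_, ha'⟩, ⟨a⁻¹, inv_ne_zero ha, FractionalIdeal.coe_spanSingleton _ _⟩, ?_⟩
  have h' : (I : FractionalIdeal R⁰ L) = FractionalIdeal.spanSingleton R⁰ a :=
    FractionalIdeal.coeToSubmodule_injective (h.trans (FractionalIdeal.coe_spanSingleton _ _).symm)
  apply Subtype.ext
  rw [Submonoid.coe_mul, h', FractionalIdeal.spanSingleton_mul_spanSingleton, mul_inv_cancel₀ ha,
    FractionalIdeal.spanSingleton_one, Submonoid.coe_one]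

theorem Cl.mk_eq_mk {I J : fracIdeals R L} [IsFractionRing R L] :
    Cl.mk I = Cl.mk J ↔ ∃ A ∈ principalIdeals R L, I = A * J := by
  refine (Con.eq _).trans ⟨?_, fun ⟨A, hA, h⟩ => ⟨1, Submonoid.one_mem _, A, hA, by simpa using h⟩⟩
  rintro ⟨A, hA, B, hB, h⟩
  obtain ⟨A', hA', hAA'⟩ := exists_mul_eq_one_of_mem_principalIdeals hA
  refine ⟨A' * B, Submonoid.mul_mem _ hA' hB, ?_⟩
  rw [mul_assoc, ← h, ← mul_assoc, mul_comm A', hAA', one_mul]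

theorem Cl.mk_surjective : Function.Surjective (Cl.mk (R := R) (L := L)) :=
  Con.mk'_surjective

/-- A principal factor in `I = A * (I * J * I)` is absorbed into `J`, so regularity of a class can
be tested on ideals. -/
theorem Cl.mk_mem_Reg [IsFractionRing R L] {I : fracIdeals R L} :
    Cl.mk I ∈ Reg (Cl R L) ↔ ∃ J, I = I * J * I := by
  constructor
  · rintro ⟨b, hb⟩
    obtain ⟨J, rfl⟩ := Cl.mk_surjective b
    rw [← map_mul, ← map_mul, Cl.mk_eq_mk] at hb
    obtain ⟨A, -, h⟩ := hb
    exact ⟨A * J, by conv_lhs => rw [h, ← mul_assoc, ← mul_assoc, mul_comm A I, mul_assoc I]⟩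
  · rintro ⟨J, h⟩
    exact ⟨Cl.mk J, by rw [← map_mul, ← map_mul, ← h]⟩

theorem hasFiniteCharacter_of_Reg_eq_univ [IsFractionRing R L] [IsDomain R]
    [Ring.DimensionLEOne R] {v : MaximalSpectrum R → Additive Lˣ →+ ℚ}
    (hv : IsLocalizationFamily v) (h : Reg (Cl R L) = Set.univ) : HasFiniteCharacter R := by
  intro d hd
  by_contra hinf
  obtain ⟨B, hB, hcop⟩ := exists_comaximal_seq hd hinf
  obtain ⟨I, hI0, hI⟩ := exists_ne_mul_mul_self (L := L)
    (fun n => hv.isUnit_coeIdeal_of_fg (hB n).1 fun h0 => hd (by simpa [h0] using (hB n).2.1))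
    (fun n => (hB n).2.2) (mem_nonZeroDivisors_of_ne_zero hd) (fun n => (hB n).2.1) hcop
  obtain ⟨J, hJ⟩ := Cl.mk_mem_Reg.1 (h ▸ Set.mem_univ (Cl.mk (⟨I, hI0⟩ : fracIdeals R L)))
  exact hI J (congrArg Subtype.val hJ)

end Classes

/-! ### Gluing local data under finite character -/

section Prescribed

variable {R L : Type*} [CommRing R] [Field L] [Algebra R L] [IsFractionRing R L]
  {v : MaximalSpectrum R → Additive Lˣ →+ ℚ}

theorem IsLocalizationFamily.finite_val_ne_zero (hv : IsLocalizationFamily v)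
    (hR : HasFiniteCharacter R) (x : Lˣ) : {P | v P (.ofMul x) ≠ 0}.Finite := by
  have : Nontrivial R := (algebraMap R L).domain_nontrivial
  obtain ⟨a, s, hs, hx⟩ := IsFractionRing.div_surjective (A := R) (x : L)
  have hs0 : algebraMap R L s ≠ 0 := by simpa using nonZeroDivisors.ne_zero hs
  have ha0 : algebraMap R L a ≠ 0 := fun h => x.ne_zero (by rw [← hx, h, zero_div])
  have h : x = Units.mk0 _ ha0 / Units.mk0 _ hs0 := Units.ext (by simp [hx])
  refine ((hR a (by simpa using ha0)).union (hR s (by simpa using hs0))).subset fun P hP => ?_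
  by_contra hcon
  simp only [Set.mem_union, Set.mem_ofPred_eq, not_or] at hcon
  apply hP
  rw [h, ofMul_div, map_sub, (hv.eq_zero_iff (by simp)).2 hcon.1,
    (hv.eq_zero_iff (by simp)).2 hcon.2, sub_zero]

/-- A product of high powers of elements of `Q` outside `p`, for `Q ∈ T`; the values are rational,
hence archimedean. The case `p = ⊥` yields denominators, the case of a maximal `p` yields local
units. -/
theorem IsLocalizationFamily.exists_notMem_le_val (hv : IsLocalizationFamily v) {p : Ideal R}
    [hp : p.IsPrime] (r : MaximalSpectrum R → ℚ) (T : Finset (MaximalSpectrum R))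
    (hT : ∀ Q ∈ T, ¬ Q.asIdeal ≤ p) :
    ∃ s ∉ p, ∀ u : Lˣ, (u : L) = algebraMap R L s → ∀ Q ∈ T, r Q ≤ v Q (.ofMul u) := by
  classical
  induction T using Finset.induction with
  | empty => exact ⟨1, (Ideal.ne_top_iff_one p).1 hp.ne_top, by simp⟩
  | insert Q T _ ih =>
    obtain ⟨s, hs, h⟩ := ih fun Q' hQ' => hT Q' (Finset.mem_insert_of_mem hQ')
    obtain ⟨t, htQ, htp⟩ := Set.not_subset.1 (hT Q (Finset.mem_insert_self _ _))
    have ht0 : t ≠ 0 := fun h => htp (h ▸ p.zero_mem)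
    have hs0 : s ≠ 0 := fun h => hs (h ▸ p.zero_mem)
    obtain ⟨y, hy⟩ := exists_unit_of_ne_zero (L := L) ht0
    obtain ⟨z, hz⟩ := exists_unit_of_ne_zero (L := L) hs0
    obtain ⟨n, hn⟩ := Archimedean.arch (r Q) ((hv.pos_iff hy).2 htQ)
    refine ⟨s * t ^ n, fun hm => (hp.mem_or_mem hm).elim hs fun hm => htp (hp.mem_of_pow_mem n hm),
      fun u hu Q' hQ' => ?_⟩
    have hu' : u = z * y ^ n := Units.ext (by simp [hu, hy, hz])
    rw [hu', ofMul_mul, map_add, ofMul_pow, map_nsmul]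
    have h1 := hv.nonneg_algebraMap Q' hz
    have h2 := nsmul_nonneg (hv.nonneg_algebraMap Q' hy) n
    rcases Finset.mem_insert.1 hQ' with rfl | hQ'
    · linarith
    · linarith [h z hz Q' hQ']

/-- In a domain of finite character, a fractional ideal with prescribed localizations, almost all
of which are trivial. -/
theorem IsLocalizationFamily.exists_valueSet_eq [IsDomain R] (hv : IsLocalizationFamily v)
    (hR : HasFiniteCharacter R) (hbot : ∀ P : MaximalSpectrum R, P.asIdeal ≠ ⊥)
    (U : MaximalSpectrum R → Set ℚ) (hup : ∀ P, IsUpperSet (U P))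
    (hne : ∀ P, ∃ x : Lˣ, v P (.ofMul x) ∈ U P) (hbdd : ∀ P, BddBelow (U P))
    (hfin : {P | U P ≠ Set.Ici 0}.Finite) :
    ∃ I : fracIdeals R L, ∀ P, valueSet (v P) (I : FractionalIdeal R⁰ L) =
      U P ∩ Set.range fun x : Lˣ => v P (.ofMul x) := by
  classical
  choose b hb using hbdd
  choose y hy using hne
  let N : Submodule R L :=
    { carrier := {x | ∀ u : Lˣ, (u : L) = x → ∀ P, v P (.ofMul u) ∈ U P}
      zero_mem' := fun u hu => absurd hu u.ne_zero
      add_mem' := by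
        intro x z hx hz u hu P
        by_cases hx0 : x = 0
        · exact hz u (by rw [hu, hx0, zero_add]) P
        by_cases hz0 : z = 0
        · exact hx u (by rw [hu, hz0, add_zero]) P
        have h1 := hx (Units.mk0 x hx0) rfl P
        have h2 := hz (Units.mk0 z hz0) rfl P
        rcases le_total (v P (.ofMul (Units.mk0 x hx0))) (v P (.ofMul (Units.mk0 z hz0)))
          with h | h
        · exact hup P (hv.le_add hu le_rfl h) h1
        · exact hup P (hv.le_add hu h le_rfl) h2
      smul_mem' := by
        intro r x hx u hu P
        rw [Algebra.smul_def] at hu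
        have h0 : algebraMap R L r * x ≠ 0 := hu ▸ u.ne_zero
        have hr : u = Units.mk0 _ (left_ne_zero_of_mul h0) * Units.mk0 _ (right_ne_zero_of_mul h0) :=
          Units.ext hu
        refine hup P ?_ (hx (Units.mk0 _ (right_ne_zero_of_mul h0)) rfl P)
        rw [hr, ofMul_mul, map_add]
        have := hv.nonneg_algebraMap P (u := Units.mk0 _ (left_ne_zero_of_mul h0)) rfl
        linarith }
  have hfrac : IsFractional R⁰ N := by
    obtain ⟨s, hs, h⟩ := hv.exists_notMem_le_val (p := ⊥) (fun P => -b P) hfin.toFinset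
      fun Q _ hQ => hbot Q (le_bot_iff.1 hQ)
    have hs0 : s ≠ 0 := hs
    refine ⟨s, mem_nonZeroDivisors_of_ne_zero hs0, fun x hx => ?_⟩
    by_cases hx0 : x = 0
    · exact ⟨0, by simp [hx0]⟩
    obtain ⟨u, hu⟩ := exists_unit_of_ne_zero (L := L) hs0
    have : ((u * Units.mk0 x hx0 : Lˣ) : L) ∈ (1 : FractionalIdeal R⁰ L) := by
      refine hv.mem_one_iff.2 fun P => ?_
      have hxP := hx (Units.mk0 x hx0) rfl P
      rw [ofMul_mul, map_add]
      by_cases hP : U P = Set.Ici 0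
      · rw [hP] at hxP
        exact add_nonneg (hv.nonneg_algebraMap P hu) hxP
      · have := h u hu P (by simpa using hP)
        have := hb P hxP
        linarith
    obtain ⟨a, ha⟩ := (FractionalIdeal.mem_one_iff _).1 this
    exact ⟨a, by rw [ha, Algebra.smul_def, Units.val_mul, hu, Units.val_mk0]⟩
  let I : FractionalIdeal R⁰ L := ⟨N, hfrac⟩
  have hI : ∀ P, valueSet (v P) I = U P ∩ Set.range fun x : Lˣ => v P (.ofMul x) := by
    intro P
    ext q
    constructor
    · rintro ⟨x, hx, rfl⟩
      exact ⟨hx x rfl P, x, rfl⟩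
    · rintro ⟨hq, x, rfl⟩
      have := P.isMaximal.isPrime
      -- At the finitely many `Q ≠ P` where `U Q` or the value of `x` is nontrivial, a factor `s ∉
      -- P` raises the value of `x` to at least that of `y Q`. At `P` the value is unchanged, and at
      -- the remaining `Q` the product has value at least `0`.
      let T := (hfin.toFinset ∪ (hv.finite_val_ne_zero hR x).toFinset).erase P
      obtain ⟨s, hs, h⟩ := hv.exists_notMem_le_val (p := P.asIdeal)
        (fun Q => v Q (.ofMul (y Q)) - v Q (.ofMul x)) T fun Q hQ hQP =>
          (Finset.mem_erase.1 hQ).1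
            (MaximalSpectrum.ext (Q.isMaximal.eq_of_le P.isMaximal.ne_top hQP))
      obtain ⟨u, hu⟩ := exists_unit_of_ne_zero (L := L)
        (fun h0 : s = 0 => hs (h0 ▸ Ideal.zero_mem _))
      have hP : v P (.ofMul (u * x)) = v P (.ofMul x) := by
        rw [ofMul_mul, map_add, (hv.eq_zero_iff hu).2 hs, zero_add]
      refine ⟨u * x, fun w hw Q => ?_, hP⟩
      obtain rfl : w = u * x := Units.ext hw
      by_cases hQP : Q = P
      · rw [hQP, hP]; exact hq
      by_cases hQT : Q ∈ T
      · refine hup Q ?_ (hy Q)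
        rw [ofMul_mul, map_add]
        linarith [h u hu Q hQT]
      · simp only [T, Finset.mem_erase, Finset.mem_union, Set.Finite.mem_toFinset,
          Set.mem_ofPred_eq, not_and, not_or, not_not] at hQT
        obtain ⟨h1, h2⟩ := hQT hQP
        rw [h1, ofMul_mul, map_add, h2, add_zero]
        exact hv.nonneg_algebraMap Q hu
  refine ⟨⟨I, fun h0 => ?_⟩, hI⟩
  obtain ⟨M, hM⟩ := Ideal.exists_maximal R
  have : v ⟨M, hM⟩ (.ofMul (y ⟨M, hM⟩)) ∈ valueSet (v ⟨M, hM⟩) I := by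
    rw [hI]; exact ⟨hy _, _, rfl⟩
  obtain ⟨x, hx, -⟩ := this
  exact x.ne_zero (FractionalIdeal.eq_zero_iff.1 h0 _ hx)

theorem IsLocalizationFamily.bddBelow_valueSet (hv : IsLocalizationFamily v)
    (I : FractionalIdeal R⁰ L) :
    ∃ d : Lˣ, ∀ P, ∀ q ∈ valueSet (v P) I, v P (.ofMul d) ≤ q := by
  obtain ⟨d, hd, h⟩ := I.isFractional
  have : Nontrivial R := (algebraMap R L).domain_nontrivial
  obtain ⟨u, hu⟩ := exists_unit_of_ne_zero (L := L) (nonZeroDivisors.ne_zero hd)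
  refine ⟨u⁻¹, fun P q hq => ?_⟩
  obtain ⟨x, hx, rfl⟩ := hq
  obtain ⟨a, ha⟩ := h x hx
  have := hv.nonneg_algebraMap P (u := u * x) (a := a) (by
    rw [ha, Units.val_mul, hu, Algebra.smul_def])
  rw [ofMul_mul, map_add] at this
  rw [ofMul_inv, map_neg]
  linarith

/-- Take a nonzero `x ∈ I` and the inverse `d` of a denominator of `I`. Wherever both have value
`0`, the values on `I` are nonnegative and include `0`. -/
theorem IsLocalizationFamily.finite_valueSet_ne (hv : IsLocalizationFamily v)
    (hR : HasFiniteCharacter R) (I : fracIdeals R L) :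
    {P | valueSet (v P) (I : FractionalIdeal R⁰ L) ≠
      valueSet (v P) (1 : FractionalIdeal R⁰ L)}.Finite := by
  obtain ⟨x, hx⟩ := exists_unit_mem I.2
  obtain ⟨d, hd⟩ := hv.bddBelow_valueSet (I : FractionalIdeal R⁰ L)
  refine ((hv.finite_val_ne_zero hR x).union (hv.finite_val_ne_zero hR d)).subset fun P hP => ?_
  by_contra hcon
  simp only [Set.mem_union, Set.mem_ofPred_eq, not_or, not_not] at hcon
  refine hP (Set.ext fun q => ?_)
  rw [hv.mem_valueSet_one]
  constructor
  · intro hq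
    obtain ⟨z, -, hz⟩ := id hq
    exact ⟨hcon.2 ▸ hd P q hq, z, hz⟩
  · rintro ⟨hq, z, rfl⟩
    exact hv.val_mem_valueSet ⟨x, hx, rfl⟩ (hcon.1 ▸ hq)

end Prescribed

theorem withZero_eq_zero_of_add_eq_zero {G : Type*} [AddGroup G] {a b : WithZero G}
    (h : a + b = 0) : a = 0 := by
  by_contra ha
  obtain ⟨x, rfl⟩ := WithZero.ne_zero_iff_exists.1 ha
  by_cases hb : b = 0
  · exact ha (by rwa [hb, add_zero] at h)
  · obtain ⟨y, rfl⟩ := WithZero.ne_zero_iff_exists.1 hb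
    rw [← WithZero.coe_add] at h
    exact WithZero.coe_ne_zero h

/-! ### Local components and their fibres -/

section Component

variable {R L : Type*} [CommRing R] [Field L] [Algebra R L]

/-- The value group of `w` as a subgroup of the real numbers. -/
noncomputable def realValueGroup (w : Additive Lˣ →+ ℚ) : AddSubgroup ℝ :=
  (((Rat.castHom ℝ).toAddMonoidHom).comp w).range

/-- The values under `w` of the non-zero elements of `I`, as a set of real numbers. -/
def realValues (w : Additive Lˣ →+ ℚ) (I : fracIdeals R L) : Set ℝ :=
  {r | ∃ x : Lˣ, (x : L) ∈ (I : FractionalIdeal R⁰ L) ∧ r = (w (.ofMul x) : ℝ)}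

open Classical in
/-- The infimum of the values of `I` modulo the value group, or the neutral element if this infimum
is attained. -/
noncomputable def localComponent (w : Additive Lˣ →+ ℚ) (I : fracIdeals R L) :
    WithZero (ℝ ⧸ realValueGroup w) :=
  if sInf (realValues w I) ∈ realValues w I then 0
  else ((sInf (realValues w I) : ℝ) : ℝ ⧸ realValueGroup w)

theorem mem_realValueGroup {w : Additive Lˣ →+ ℚ} {r : ℝ} :
    r ∈ realValueGroup w ↔ ∃ x : Lˣ, (w (.ofMul x) : ℝ) = r :=
  Iff.rfl

theorem mem_realValues {w : Additive Lˣ →+ ℚ} {I : fracIdeals R L} {r : ℝ} :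
    r ∈ realValues w I ↔ ∃ q ∈ valueSet w (I : FractionalIdeal R⁰ L), r = q :=
  ⟨fun ⟨x, hx, h⟩ => ⟨_, ⟨x, hx, rfl⟩, h⟩, fun ⟨_, ⟨x, hx, hq⟩, h⟩ => ⟨x, hx, by rw [h, hq]⟩⟩

theorem realValues_subset (w : Additive Lˣ →+ ℚ) (I : fracIdeals R L) :
    realValues w I ⊆ realValueGroup w := by
  rintro r ⟨x, -, rfl⟩
  exact mem_realValueGroup.2 ⟨x, rfl⟩

theorem realValues_nonempty (w : Additive Lˣ →+ ℚ) (I : fracIdeals R L) :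
    (realValues w I).Nonempty :=
  let ⟨x, hx⟩ := exists_unit_mem I.2
  ⟨_, x, hx, rfl⟩

theorem localComponent_of_mem {w : Additive Lˣ →+ ℚ} {I : fracIdeals R L}
    (h : sInf (realValues w I) ∈ realValues w I) : localComponent w I = 0 :=
  if_pos h

theorem localComponent_of_notMem {w : Additive Lˣ →+ ℚ} {I : fracIdeals R L}
    (h : sInf (realValues w I) ∉ realValues w I) :
    localComponent w I = ((sInf (realValues w I) : ℝ) : ℝ ⧸ realValueGroup w) :=
  if_neg h

/-- Values on `I` accumulate at the infimum from above, and their differences are arbitrarily small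
positive elements of the value group. -/
theorem dense_of_sInf_notMem {w : Additive Lˣ →+ ℚ} {I : fracIdeals R L}
    (hb : BddBelow (realValues w I)) (h : sInf (realValues w I) ∉ realValues w I) :
    Dense (realValueGroup w : Set ℝ) := by
  refine AddSubgroup.dense_of_not_isolated_zero _ fun ε hε => ?_
  have hne := realValues_nonempty w I
  obtain ⟨a, ha, hlt⟩ := exists_lt_of_csInf_lt hne (lt_add_of_pos_right (sInf (realValues w I)) hε)
  have ha' : sInf (realValues w I) < a :=
    lt_of_le_of_ne (csInf_le hb ha) fun h' => h (h' ▸ ha)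
  obtain ⟨b, hb', hlt'⟩ := exists_lt_of_csInf_lt hne ha'
  refine ⟨a - b, sub_mem (realValues_subset w I ha) (realValues_subset w I hb'), ?_, ?_⟩
  · linarith
  · linarith [csInf_le hb hb']

variable [IsFractionRing R L] {v : MaximalSpectrum R → Additive Lˣ →+ ℚ}

namespace IsLocalizationFamily
variable (hv : IsLocalizationFamily v)
include hv

theorem bddBelow_realValues (P : MaximalSpectrum R) (I : fracIdeals R L) :
    BddBelow (realValues (v P) I) := by
  obtain ⟨d, hd⟩ := hv.bddBelow_valueSet (I : FractionalIdeal R⁰ L)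
  refine ⟨v P (.ofMul d), fun r hr => ?_⟩
  obtain ⟨q, hq, rfl⟩ := mem_realValues.1 hr
  exact_mod_cast hd P q hq

open scoped Pointwise in
theorem realValues_mul (P : MaximalSpectrum R) (I J : fracIdeals R L) :
    realValues (v P) (I * J) = realValues (v P) I + realValues (v P) J := by
  ext r
  rw [Set.mem_add]
  simp only [mem_realValues, Submonoid.coe_mul, hv.mem_valueSet_mul]
  constructor
  · rintro ⟨_, ⟨a, ha, b, hb, rfl⟩, rfl⟩
    exact ⟨a, ⟨a, ha, rfl⟩, b, ⟨b, hb, rfl⟩, by push_cast; rfl⟩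
  · rintro ⟨_, ⟨a, ha, rfl⟩, _, ⟨b, hb, rfl⟩, rfl⟩
    exact ⟨_, ⟨a, ha, b, hb, rfl⟩, by push_cast; rfl⟩

/-- Infima add, and the infimum of the product is attained exactly when both are. An attained
infimum lies in the value group, so it does not affect the class of the other one. -/
theorem localComponent_mul (P : MaximalSpectrum R) (I J : fracIdeals R L) :
    localComponent (v P) (I * J) = localComponent (v P) I + localComponent (v P) J := by
  have hIJ := hv.realValues_mul P I J
  have hbI := hv.bddBelow_realValues P I
  have hbJ := hv.bddBelow_realValues P J
  have hinf : sInf (realValues (v P) (I * J)) =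
      sInf (realValues (v P) I) + sInf (realValues (v P) J) := by
    rw [hIJ, csInf_add (realValues_nonempty _ I) hbI (realValues_nonempty _ J) hbJ]
  have hmem : sInf (realValues (v P) (I * J)) ∈ realValues (v P) (I * J) ↔
      sInf (realValues (v P) I) ∈ realValues (v P) I ∧
        sInf (realValues (v P) J) ∈ realValues (v P) J := by
    rw [hinf, hIJ, Set.mem_add]
    constructor
    · rintro ⟨a, ha, b, hb, hab⟩
      have h1 := csInf_le hbI ha
      have h2 := csInf_le hbJ hb
      have h3 : a = sInf (realValues (v P) I) := by linarith
      have h4 : b = sInf (realValues (v P) J) := by linarith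
      exact ⟨h3 ▸ ha, h4 ▸ hb⟩
    · exact fun ⟨h1, h2⟩ => ⟨_, h1, _, h2, rfl⟩
  by_cases hI : sInf (realValues (v P) I) ∈ realValues (v P) I <;>
    by_cases hJ : sInf (realValues (v P) J) ∈ realValues (v P) J
  · rw [localComponent_of_mem (hmem.2 ⟨hI, hJ⟩), localComponent_of_mem hI,
      localComponent_of_mem hJ, add_zero]
  · rw [localComponent_of_notMem fun h => hJ (hmem.1 h).2, localComponent_of_mem hI,
      localComponent_of_notMem hJ, zero_add, hinf, QuotientAddGroup.mk_add,
      (QuotientAddGroup.eq_zero_iff _).2 (realValues_subset _ I hI), zero_add]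
  · rw [localComponent_of_notMem fun h => hI (hmem.1 h).1, localComponent_of_mem hJ,
      localComponent_of_notMem hI, add_zero, hinf, QuotientAddGroup.mk_add,
      (QuotientAddGroup.eq_zero_iff _).2 (realValues_subset _ J hJ), add_zero]
  · rw [localComponent_of_notMem fun h => hI (hmem.1 h).1, localComponent_of_notMem hI,
      localComponent_of_notMem hJ, hinf, QuotientAddGroup.mk_add, WithZero.coe_add]

theorem localComponent_of_valueSet_eq_one (P : MaximalSpectrum R) {I : fracIdeals R L}
    (h : valueSet (v P) (I : FractionalIdeal R⁰ L) = valueSet (v P) (1 : FractionalIdeal R⁰ L)) :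
    localComponent (v P) I = 0 := by
  have : IsLeast (realValues (v P) I) 0 := by
    constructor
    · refine mem_realValues.2 ⟨0, ?_, by simp⟩
      rw [h, hv.mem_valueSet_one]
      exact ⟨le_rfl, 1, by simp⟩
    · intro r hr
      obtain ⟨q, hq, rfl⟩ := mem_realValues.1 hr
      rw [h, hv.mem_valueSet_one] at hq
      exact_mod_cast hq.1
  exact localComponent_of_mem this.csInf_mem

theorem localComponent_one (P : MaximalSpectrum R) :
    localComponent (v P) (1 : fracIdeals R L) = 0 :=
  hv.localComponent_of_valueSet_eq_one P rfl

theorem localComponent_of_mem_invertibleIdeals (P : MaximalSpectrum R) {I : fracIdeals R L}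
    (hI : I ∈ invertibleIdeals R L) : localComponent (v P) I = 0 := by
  obtain ⟨J, hJ⟩ := hI
  have h := hv.localComponent_mul P I J
  rw [hJ, hv.localComponent_one] at h
  exact withZero_eq_zero_of_add_eq_zero h.symm

theorem mem_valueSet_iff_of_attained (P : MaximalSpectrum R) {I : fracIdeals R L}
    (h : sInf (realValues (v P) I) ∈ realValues (v P) I) (x : Lˣ) :
    v P (.ofMul x) ∈ valueSet (v P) (I : FractionalIdeal R⁰ L) ↔
      sInf (realValues (v P) I) ≤ v P (.ofMul x) := by
  refine ⟨fun hx => csInf_le (hv.bddBelow_realValues P I) (mem_realValues.2 ⟨_, hx, rfl⟩),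
    fun hx => ?_⟩
  obtain ⟨q, hq, hq'⟩ := mem_realValues.1 h
  rw [hq'] at hx
  exact hv.val_mem_valueSet hq (by exact_mod_cast hx)

theorem mem_valueSet_iff_of_not_attained (P : MaximalSpectrum R) {I : fracIdeals R L}
    (h : sInf (realValues (v P) I) ∉ realValues (v P) I) (x : Lˣ) :
    v P (.ofMul x) ∈ valueSet (v P) (I : FractionalIdeal R⁰ L) ↔
      sInf (realValues (v P) I) < v P (.ofMul x) := by
  constructor
  · intro hx
    have hx' : (v P (.ofMul x) : ℝ) ∈ realValues (v P) I := mem_realValues.2 ⟨_, hx, rfl⟩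
    exact lt_of_le_of_ne (csInf_le (hv.bddBelow_realValues P I) hx') fun h' => h (h' ▸ hx')
  · intro hx
    obtain ⟨a, ha, hax⟩ := exists_lt_of_csInf_lt (realValues_nonempty _ I) hx
    obtain ⟨q, hq, rfl⟩ := mem_realValues.1 ha
    exact hv.val_mem_valueSet hq (by exact_mod_cast hax.le)

/-- Local ideals with the same component differ by a principal one. -/
theorem exists_shift_of_localComponent_eq (P : MaximalSpectrum R) {I J : fracIdeals R L}
    (h : Dense (realValueGroup (v P) : Set ℝ) → localComponent (v P) I = localComponent (v P) J) :
    ∃ g : Lˣ, ∀ x : Lˣ, v P (.ofMul x) ∈ valueSet (v P) (J : FractionalIdeal R⁰ L) ↔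
      v P (.ofMul (x / g)) ∈ valueSet (v P) (I : FractionalIdeal R⁰ L) := by
  have hbI := hv.bddBelow_realValues P I
  have hbJ := hv.bddBelow_realValues P J
  by_cases hI : sInf (realValues (v P) I) ∈ realValues (v P) I <;>
    by_cases hJ : sInf (realValues (v P) J) ∈ realValues (v P) J
  · obtain ⟨a, ha⟩ := mem_realValueGroup.1 (sub_mem (realValues_subset _ J hJ)
      (realValues_subset _ I hI))
    refine ⟨a, fun x => ?_⟩
    rw [hv.mem_valueSet_iff_of_attained P hJ, hv.mem_valueSet_iff_of_attained P hI, ofMul_div,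
      map_sub]
    push_cast
    rw [ha]
    constructor <;> intro h <;> linarith
  -- An infimum that is not attained makes the value group dense, so the hypothesis applies; but one
  -- component is the adjoined zero and the other is not.
  · have h' := h (dense_of_sInf_notMem hbJ hJ)
    rw [localComponent_of_mem hI, localComponent_of_notMem hJ] at h'
    exact absurd h'.symm WithZero.coe_ne_zero
  · have h' := h (dense_of_sInf_notMem hbI hI)
    rw [localComponent_of_mem hJ, localComponent_of_notMem hI] at h'
    exact absurd h' WithZero.coe_ne_zero
  · have h' := h (dense_of_sInf_notMem hbI hI)
    rw [localComponent_of_notMem hJ, localComponent_of_notMem hI, WithZero.coe_inj,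
      QuotientAddGroup.eq] at h'
    obtain ⟨a, ha⟩ := mem_realValueGroup.1 h'
    refine ⟨a, fun x => ?_⟩
    rw [hv.mem_valueSet_iff_of_not_attained P hJ, hv.mem_valueSet_iff_of_not_attained P hI,
      ofMul_div, map_sub]
    push_cast
    rw [ha]
    constructor <;> intro h <;> linarith

/-- Gluing the inverses of the `g P` in the same way gives the inverse ideal. -/
theorem exists_invertible_valueSet [IsDomain R] (hR : HasFiniteCharacter R)
    (hbot : ∀ P : MaximalSpectrum R, P.asIdeal ≠ ⊥) (g : MaximalSpectrum R → Lˣ)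
    (hg : {P | g P ≠ 1}.Finite) :
    ∃ A ∈ invertibleIdeals R L, ∀ (P : MaximalSpectrum R) (x : Lˣ),
      v P (.ofMul x) ∈ valueSet (v P) (A : FractionalIdeal R⁰ L) ↔
        v P (.ofMul (g P)) ≤ v P (.ofMul x) := by
  have main : ∀ g : MaximalSpectrum R → Lˣ, {P | g P ≠ 1}.Finite → ∃ A : fracIdeals R L,
      ∀ (P : MaximalSpectrum R), valueSet (v P) (A : FractionalIdeal R⁰ L) =
        Set.Ici (v P (.ofMul (g P))) ∩ Set.range fun x : Lˣ => v P (.ofMul x) := by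
    intro g hg
    refine hv.exists_valueSet_eq hR hbot (fun P => Set.Ici (v P (.ofMul (g P))))
      (fun P => isUpperSet_Ici _) (fun P => ⟨g P, Set.self_mem_Ici⟩) (fun P => bddBelow_Ici)
      (hg.subset fun P hP h1 => hP ?_)
    simp [h1]
  obtain ⟨A, hA⟩ := main g hg
  obtain ⟨B, hB⟩ := main (fun P => (g P)⁻¹) (by simpa using hg)
  refine ⟨A, ⟨B, Subtype.ext (hv.ext fun P => Set.ext fun q => ?_)⟩, fun P x => ?_⟩
  · rw [Submonoid.coe_mul, Submonoid.coe_one, hv.mem_valueSet_one, hv.mem_valueSet_mul, hA, hB]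
    constructor
    · rintro ⟨_, ⟨ha, a, rfl⟩, _, ⟨hb, b, rfl⟩, rfl⟩
      simp only [Set.mem_Ici, ofMul_inv, map_neg] at ha hb ⊢
      exact ⟨by linarith, a * b, by rw [ofMul_mul, map_add]⟩
    · rintro ⟨h0, x, rfl⟩
      refine ⟨_, ⟨?_, x * g P, rfl⟩, _, ⟨?_, (g P)⁻¹, rfl⟩, ?_⟩
      · simpa using h0
      · exact Set.self_mem_Ici
      · simp
  · rw [hA]
    exact ⟨fun h => h.1, fun h => ⟨h, x, rfl⟩⟩

/-- Locally `J` is `g P` times `I`. Choosing `g P = 1` wherever the value sets agree leaves only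
finitely many nontrivial `g P`, so they glue to an invertible ideal. -/
theorem exists_invertible_mul_eq [IsDomain R] (hR : HasFiniteCharacter R)
    (hbot : ∀ P : MaximalSpectrum R, P.asIdeal ≠ ⊥) {I J : fracIdeals R L}
    (h : ∀ P, Dense (realValueGroup (v P) : Set ℝ) →
      localComponent (v P) I = localComponent (v P) J) :
    ∃ A ∈ invertibleIdeals R L, J = A * I := by
  have key : ∀ P, ∃ g : Lˣ, (valueSet (v P) (I : FractionalIdeal R⁰ L) =
      valueSet (v P) (J : FractionalIdeal R⁰ L) → g = 1) ∧
      ∀ x : Lˣ, v P (.ofMul x) ∈ valueSet (v P) (J : FractionalIdeal R⁰ L) ↔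
        v P (.ofMul (x / g)) ∈ valueSet (v P) (I : FractionalIdeal R⁰ L) := by
    intro P
    by_cases heq : valueSet (v P) (I : FractionalIdeal R⁰ L) =
      valueSet (v P) (J : FractionalIdeal R⁰ L)
    · exact ⟨1, fun _ => rfl, fun x => by rw [heq, div_one]⟩
    · obtain ⟨g, hg⟩ := hv.exists_shift_of_localComponent_eq P (h P)
      exact ⟨g, fun h => absurd h heq, hg⟩
  choose g hg1 hg using key
  obtain ⟨A, hA, hAg⟩ := hv.exists_invertible_valueSet hR hbot g
    (((hv.finite_valueSet_ne hR I).union (hv.finite_valueSet_ne hR J)).subset fun P hP => by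
      by_contra hcon
      simp only [Set.mem_union, Set.mem_ofPred_eq, not_or, not_not] at hcon
      exact hP (hg1 P (hcon.1.trans hcon.2.symm)))
  refine ⟨A, hA, Subtype.ext (hv.ext fun P => Set.ext fun q => ?_)⟩
  rw [Submonoid.coe_mul, hv.mem_valueSet_mul]
  constructor
  · rintro ⟨x, hx, rfl⟩
    refine ⟨_, (hAg P (g P)).2 le_rfl, _, (hg P x).1 ⟨x, hx, rfl⟩, ?_⟩
    rw [ofMul_div, map_sub, add_sub_cancel]
  · rintro ⟨_, ⟨a, ha, rfl⟩, _, ⟨b, hb, rfl⟩, rfl⟩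
    have ha' := (hAg P a).1 ⟨a, ha, rfl⟩
    have := hv.val_mem_valueSet (x := a * b / g P) ⟨b, hb, rfl⟩ (by
      rw [ofMul_div, map_sub, ofMul_mul, map_add]; linarith)
    rw [← hg P, ofMul_mul, map_add] at this
    exact this

omit [IsFractionRing R L] hv in
/-- Every element of `{0} ⊔ ℝ / Γ` with `Γ` dense is a local component. -/
theorem exists_upperSet_localComponent_eq {w : Additive Lˣ →+ ℚ}
    (hd : Dense (realValueGroup w : Set ℝ)) (r : ℝ) :
    (∃ x : Lˣ, w (.ofMul x) ∈ {q : ℚ | r < q}) ∧ ∀ I : fracIdeals R L,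
      valueSet w (I : FractionalIdeal R⁰ L) =
        {q : ℚ | r < q} ∩ Set.range (fun x : Lˣ => w (.ofMul x)) →
      localComponent w I = ((r : ℝ ⧸ realValueGroup w) : WithZero (ℝ ⧸ realValueGroup w)) := by
  have hex : ∀ t, r < t → ∃ x : Lˣ, r < w (.ofMul x) ∧ (w (.ofMul x) : ℝ) < t := by
    intro t ht
    obtain ⟨a, ha, h1, h2⟩ := hd.exists_between ht
    obtain ⟨x, rfl⟩ := mem_realValueGroup.1 ha
    exact ⟨x, h1, h2⟩
  refine ⟨?_, fun I hI => ?_⟩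
  · obtain ⟨x, hx, -⟩ := hex (r + 1) (by linarith)
    exact ⟨x, hx⟩
  · have hgt : ∀ a ∈ realValues w I, r < a := by
      intro a ha
      obtain ⟨q, hq, rfl⟩ := mem_realValues.1 ha
      rw [hI] at hq
      exact hq.1
    have hinf : sInf (realValues w I) = r := by
      refine csInf_eq_of_forall_ge_of_forall_gt_exists_lt (realValues_nonempty w I)
        (fun a ha => (hgt a ha).le) fun t ht => ?_
      obtain ⟨x, h1, h2⟩ := hex t ht
      exact ⟨_, mem_realValues.2 ⟨_, hI ▸ ⟨h1, x, rfl⟩, rfl⟩, h2⟩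
    rw [localComponent_of_notMem (hinf ▸ fun h => lt_irrefl _ (hgt r h)), hinf]

theorem exists_localComponent_eq [IsDomain R] (hR : HasFiniteCharacter R)
    (hbot : ∀ P : MaximalSpectrum R, P.asIdeal ≠ ⊥)
    (c : ∀ P : MaximalSpectrum R, WithZero (ℝ ⧸ realValueGroup (v P)))
    (hc : {P | c P ≠ 0}.Finite) :
    ∃ I : fracIdeals R L, ∀ P, Dense (realValueGroup (v P) : Set ℝ) →
      localComponent (v P) I = c P := by
  have key : ∀ P, ∃ U : Set ℚ, IsUpperSet U ∧ (∃ x : Lˣ, v P (.ofMul x) ∈ U) ∧ BddBelow U ∧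
      (c P = 0 → U = Set.Ici 0) ∧ ∀ I : fracIdeals R L, Dense (realValueGroup (v P) : Set ℝ) →
        valueSet (v P) (I : FractionalIdeal R⁰ L) =
          U ∩ Set.range (fun x : Lˣ => v P (.ofMul x)) → localComponent (v P) I = c P := by
    intro P
    by_cases h0 : c P = 0 ∨ ¬ Dense (realValueGroup (v P) : Set ℝ)
    -- The trivial cut serves also where the value group is not dense, since nothing is required
    -- there.
    · refine ⟨Set.Ici 0, isUpperSet_Ici _, ⟨1, by simp⟩, bddBelow_Ici, fun _ => rfl,
        fun I hd hI => ?_⟩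
      rw [h0.resolve_right (not_not.2 hd)]
      refine hv.localComponent_of_valueSet_eq_one P (hI.trans (Set.ext fun q => ?_))
      rw [hv.mem_valueSet_one]
      exact Iff.rfl
    · rw [not_or, not_not] at h0
      obtain ⟨hc0, hd⟩ := h0
      obtain ⟨y, hy⟩ := WithZero.ne_zero_iff_exists.1 hc0
      obtain ⟨r, rfl⟩ := QuotientAddGroup.mk_surjective y
      obtain ⟨h1, h2⟩ := exists_upperSet_localComponent_eq (R := R) hd r
      refine ⟨{q : ℚ | r < q}, fun a b hab ha =>
        lt_of_lt_of_le (Set.mem_ofPred.1 ha) (by exact_mod_cast hab), h1, ?_, fun h => absurd h hc0, fun I _ hI => (h2 I hI).trans hy⟩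
      obtain ⟨q, hq⟩ := exists_rat_lt r
      exact ⟨q, fun a ha => by exact_mod_cast (hq.trans ha).le⟩
  choose U h1 h2 h3 h4 h5 using key
  obtain ⟨I, hI⟩ := hv.exists_valueSet_eq hR hbot U h1 h2 h3
    (hc.subset fun P hP h => hP (h4 P h))
  exact ⟨I, fun P hd => h5 P I hd (hI P)⟩

end IsLocalizationFamily
end Component

/-! ### The isomorphism and the Clifford property -/

section Isomorphism

theorem quotCon_le_ker {M M' : Type*} [CommMonoid M] [CommMonoid M'] {N : Submonoid M}
    {f : M →* M'} (h : ∀ n ∈ N, f n = 1) : quotCon N ≤ Con.ker f := by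
  rintro x y ⟨a, ha, b, hb, hab⟩
  have := congrArg f hab
  rwa [map_mul, map_mul, h a ha, h b hb, one_mul, one_mul] at this

variable {R L : Type*} [CommRing R] [Field L] [Algebra R L]

theorem ClModPic.mk_surjective : Function.Surjective (ClModPic.mk (R := R) (L := L)) :=
  Con.mk'_surjective.comp Cl.mk_surjective

theorem exists_inverse_mem_invertibleIdeals {A : fracIdeals R L} (hA : A ∈ invertibleIdeals R L) :
    ∃ B ∈ invertibleIdeals R L, A * B = 1 :=
  let ⟨B, hB⟩ := hA
  ⟨B, ⟨A, by rw [mul_comm, hB]⟩, hB⟩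

theorem ClModPic.mk_eq_mk_of_eq_mul {I J A : fracIdeals R L} (hA : A ∈ invertibleIdeals R L)
    (h : J = A * I) : ClModPic.mk I = ClModPic.mk J := by
  refine (Con.eq _).2 ⟨Cl.mk A, ⟨A, hA, rfl⟩, 1, Submonoid.one_mem _, ?_⟩
  rw [← map_mul, ← h, one_mul]

/-- A homomorphism that is trivial on the invertible ideals, on classes modulo the Picard group. -/
noncomputable def ClModPic.lift {M : Type*} [CommMonoid M] (f : fracIdeals R L →* M)
    (hf : ∀ A ∈ invertibleIdeals R L, f A = 1)
    (hp : ∀ A ∈ principalIdeals R L, f A = 1) : ClModPic R L →* M :=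
  (quotCon (Pic R L)).lift ((quotCon (principalIdeals R L)).lift f (quotCon_le_ker hp))
    (quotCon_le_ker (by
      rintro _ ⟨A, hA, rfl⟩
      exact hf A hA))

variable [IsFractionRing R L] {v : MaximalSpectrum R → Additive Lˣ →+ ℚ}

theorem mem_invertibleIdeals_of_mem_principalIdeals {A : fracIdeals R L}
    (hA : A ∈ principalIdeals R L) : A ∈ invertibleIdeals R L :=
  let ⟨B, _, hB⟩ := exists_mul_eq_one_of_mem_principalIdeals hA
  ⟨B, hB⟩

theorem exists_invertible_mul_eq_of_mk_eq_mk {I J : fracIdeals R L}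
    (h : ClModPic.mk I = ClModPic.mk J) : ∃ A ∈ invertibleIdeals R L, J = A * I := by
  obtain ⟨_, ⟨A, hA, rfl⟩, _, ⟨B, hB, rfl⟩, hAB⟩ := (Con.eq _).1 h
  change Cl.mk A * Cl.mk I = Cl.mk B * Cl.mk J at hAB
  rw [← map_mul, ← map_mul, eq_comm, Cl.mk_eq_mk] at hAB
  obtain ⟨C, hC, hC'⟩ := hAB
  obtain ⟨B', hB', hBB'⟩ := exists_inverse_mem_invertibleIdeals hB
  refine ⟨B' * (C * A), Submonoid.mul_mem _ hB'
    (Submonoid.mul_mem _ (mem_invertibleIdeals_of_mem_principalIdeals hC) hA), ?_⟩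
  rw [mul_assoc, mul_assoc, ← hC', ← mul_assoc, mul_comm B', hBB', one_mul]

theorem Reg_Cl_eq_univ_of_Reg_ClModPic (h : Reg (ClModPic R L) = Set.univ) :
    Reg (Cl R L) = Set.univ := by
  refine Set.eq_univ_of_forall fun a => ?_
  obtain ⟨I, rfl⟩ := Cl.mk_surjective a
  obtain ⟨b, hb⟩ : ClModPic.mk I ∈ Reg (ClModPic R L) := h ▸ Set.mem_univ _
  obtain ⟨J, rfl⟩ := ClModPic.mk_surjective b
  rw [← map_mul, ← map_mul, eq_comm] at hb
  obtain ⟨A, -, hA⟩ := exists_invertible_mul_eq_of_mk_eq_mk hb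
  refine Cl.mk_mem_Reg.2 ⟨A * J, hA.trans ?_⟩
  rw [← mul_assoc, ← mul_assoc, mul_comm A I, mul_assoc I]

namespace IsLocalizationFamily

theorem exists_addEquiv [IsDomain R] (hv : IsLocalizationFamily v) (hR : HasFiniteCharacter R)
    (hbot : ∀ P : MaximalSpectrum R, P.asIdeal ≠ ⊥) :
    ∃ e : Additive (ClModPic R L) ≃+
        ⨁ P : {P : MaximalSpectrum R // Dense (realValueGroup (v P) : Set ℝ)},
          WithZero (ℝ ⧸ realValueGroup (v P.1)),
      ∀ (I : fracIdeals R L)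
        (P : {P : MaximalSpectrum R // Dense (realValueGroup (v P) : Set ℝ)}),
        e (Additive.ofMul (ClModPic.mk I)) P = localComponent (v P.1) I := by
  classical
  let X := {P : MaximalSpectrum R // Dense (realValueGroup (v P) : Set ℝ)}
  have hfin : ∀ I : fracIdeals R L, {P : X | localComponent (v P.1) I ≠ 0}.Finite := fun I =>
    ((hv.finite_valueSet_ne hR I).preimage Subtype.val_injective.injOn).subset fun P hP h =>
      hP (hv.localComponent_of_valueSet_eq_one P.1 h)
  let φ : fracIdeals R L → ⨁ P : X, WithZero (ℝ ⧸ realValueGroup (v P.1)) := fun I =>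
    DFinsupp.mk (hfin I).toFinset fun P => localComponent (v P.1.1) I
  have hφ : ∀ I P, φ I P = localComponent (v P.1) I := by
    intro I P
    refine DFinsupp.mk_apply.trans ?_
    split_ifs with h
    · rfl
    · simpa [eq_comm] using h
  let f : fracIdeals R L →* Multiplicative (⨁ P : X, WithZero (ℝ ⧸ realValueGroup (v P.1))) :=
    { toFun := fun I => .ofAdd (φ I)
      map_one' := DFinsupp.ext fun P => (hφ 1 P).trans (hv.localComponent_one P.1)
      map_mul' := fun I J => DFinsupp.ext fun P => by
        change φ (I * J) P = (φ I + φ J) P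
        rw [DirectSum.add_apply, hφ, hφ, hφ, hv.localComponent_mul] }
  have hf : ∀ A ∈ invertibleIdeals R L, f A = 1 := fun A hA => DFinsupp.ext fun P =>
    (hφ A P).trans (hv.localComponent_of_mem_invertibleIdeals P.1 hA)
  let F := MonoidHom.toAdditiveLeft
    (ClModPic.lift f hf fun A hA => hf A (mem_invertibleIdeals_of_mem_principalIdeals hA))
  have hF : ∀ I, F (.ofMul (ClModPic.mk I)) = φ I := fun I => rfl
  have hbij : Function.Bijective F := by
    constructor
    · intro a b hab
      obtain ⟨I, hI⟩ := ClModPic.mk_surjective a.toMul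
      obtain ⟨J, hJ⟩ := ClModPic.mk_surjective b.toMul
      obtain rfl : Additive.ofMul (ClModPic.mk I) = a := congrArg Additive.ofMul hI
      obtain rfl : Additive.ofMul (ClModPic.mk J) = b := congrArg Additive.ofMul hJ
      rw [hF, hF] at hab
      obtain ⟨A, hA, h⟩ := hv.exists_invertible_mul_eq hR hbot (I := I) (J := J) fun P hP => by
        rw [← hφ I ⟨P, hP⟩, hab, hφ]
      rw [ClModPic.mk_eq_mk_of_eq_mul hA h]
    · intro g
      -- Extension of `g` by zero to the maximal ideals with non-dense value group.
      let c : ∀ P : MaximalSpectrum R, WithZero (ℝ ⧸ realValueGroup (v P)) := fun P =>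
        if h : Dense (realValueGroup (v P) : Set ℝ) then g ⟨P, h⟩ else 0
      obtain ⟨I, hI⟩ := hv.exists_localComponent_eq hR hbot c
        (((DFinsupp.finite_support g).image Subtype.val).subset fun P hP => by
          by_cases h : Dense (realValueGroup (v P) : Set ℝ)
          · refine ⟨⟨P, h⟩, ?_, rfl⟩
            exact fun h0 => hP ((dif_pos h).trans h0)
          · exact absurd (dif_neg h) hP)
      refine ⟨.ofMul (ClModPic.mk I), DFinsupp.ext fun P => ?_⟩
      rw [hF]
      exact (hφ I P).trans ((hI P.1 P.2).trans (dif_pos P.2))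
  exact ⟨AddEquiv.ofBijective F hbij, fun I P => hφ I P⟩

theorem Reg_ClModPic_eq_univ [IsDomain R] (hv : IsLocalizationFamily v)
    (hR : HasFiniteCharacter R) (hbot : ∀ P : MaximalSpectrum R, P.asIdeal ≠ ⊥) :
    Reg (ClModPic R L) = Set.univ := by
  obtain ⟨e, -⟩ := hv.exists_addEquiv hR hbot
  refine Set.eq_univ_of_forall fun a => ?_
  -- The condition `x = 0 → y = 0` keeps the support finite when the quasi-inverses are assembled in
  -- the direct sum.
  have hex : ∀ (P : MaximalSpectrum R) (x : WithZero (ℝ ⧸ realValueGroup (v P))),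
      ∃ y, (x = 0 → y = 0) ∧ x = x + y + x := by
    intro P x
    by_cases hx : x = 0
    · exact ⟨0, fun _ => rfl, by simp [hx]⟩
    · obtain ⟨y, rfl⟩ := WithZero.ne_zero_iff_exists.1 hx
      refine ⟨((-y : ℝ ⧸ realValueGroup (v P)) : WithZero _), fun h => absurd h hx, ?_⟩
      rw [← WithZero.coe_add, ← WithZero.coe_add, add_neg_cancel, zero_add]
  choose neg hneg0 hneg using hex
  let b : ⨁ P : {P : MaximalSpectrum R // Dense (realValueGroup (v P) : Set ℝ)},
      WithZero (ℝ ⧸ realValueGroup (v P.1)) :=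
    DFinsupp.mapRange (fun P => neg P.1) (fun P => hneg0 P.1 0 rfl) (e (.ofMul a))
  refine ⟨(e.symm b).toMul, Additive.ofMul.injective (e.injective ?_)⟩
  rw [ofMul_mul, ofMul_mul, map_add, map_add, ofMul_toMul, e.apply_symm_apply]
  exact DFinsupp.ext fun P => hneg P.1 (e (.ofMul a) P)

end IsLocalizationFamily
end Isomorphism
end IdealClassSemigroup

/-! ### The theorem for integral closures of Dedekind domains -/

open IdealClassSemigroup
theorem corollary2p8 {o K L : Type*} [CommRing o] [IsDedekindDomain o] (ho : ¬ IsField o)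
    [Field K] [Algebra o K] [IsFractionRing o K] [Field L] [Algebra K L]
    [Algebra.IsAlgebraic K L] [Algebra o L] [IsScalarTower o K L] :
    (Reg (Cl (integralClosure o L) L) = Set.univ ↔ HasFiniteCharacter (integralClosure o L)) ∧
    (HasFiniteCharacter (integralClosure o L) →
      ∃ e : Additive (ClModPic (integralClosure o L) L) ≃+
          ⨁ P : {P : MaximalSpectrum (integralClosure o L) // Dense (valueGroup K ho P : Set ℝ)},
            WithZero (ℝ ⧸ valueGroup K ho P.1),
        ∀ (I : fracIdeals (integralClosure o L) L)
          (P : {P : MaximalSpectrum (integralClosure o L) // Dense (valueGroup K ho P : Set ℝ)}),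
          e (Additive.ofMul (ClModPic.mk I)) P = component K ho P.1 I) := by
  have hinj : Function.Injective (algebraMap o L) := by
    rw [IsScalarTower.algebraMap_eq o K L]
    exact (algebraMap K L).injective.comp (IsFractionRing.injective o K)
  have : Algebra.IsAlgebraic o L := ⟨fun x =>
    (IsFractionRing.isAlgebraic_iff o K L).2 (Algebra.IsAlgebraic.isAlgebraic x)⟩
  have : IsFractionRing (integralClosure o L) L :=
    integralClosure.isFractionRing_of_algebraic fun x hx => hinj (hx.trans (map_zero _).symm)
  have hinj' : Function.Injective (algebraMap o (integralClosure o L)) := fun x y h =>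
    hinj (congrArg Subtype.val h)
  -- If the integral closure were a field, then so would be `o`, over which it is integral.
  have hbot : ∀ P : MaximalSpectrum (integralClosure o L), P.asIdeal ≠ ⊥ := fun P =>
    Ring.ne_bot_of_isMaximal_of_not_isField P.isMaximal fun h =>
      ho (isField_of_isIntegral_of_isField hinj' h)
  have hv : IsLocalizationFamily (R := integralClosure o L) (val K ho) := fun P =>
    (val_spec K ho P).nonneg_iff
  refine ⟨⟨hasFiniteCharacter_of_Reg_eq_univ hv, fun hR =>
    Reg_Cl_eq_univ_of_Reg_ClModPic (hv.Reg_ClModPic_eq_univ hR hbot)⟩, fun hR => ?_⟩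
  exact hv.exists_addEquiv hR hbot
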